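/- Let $K$ be an algebraically closed field of characteristic zero. (1) Let $X \subset \mathbb P^4$ be a smooth hypersurface of degree $d \ge 2$ over $K$, and let $g \in \mathrm{PGL}(5,K)$ be an automorphism of $X$ (that is, $g(X)=X$) of order $\mathrm{ord}(g) = k(d-1)$ for some integer $k \ge 2$. Let $\mathrm{Fix}(g)=\{x\in X : g(x)=x\}$. If $\mathrm{Fix}(g)$ has codimension two in $X$ and contains no projective line, then there is a point $P \in X$ that is a Galois point for $X$, i.e. the projection $\pi_P\colon X \dashrightarrow \mathbb P^3$ from $P$ induces a Galois extension of function fields $K(X)/\pi_P^*K(\mathbb P^3)$, and $\langle g^k\rangle$ is the Galois group of this projection, i.e. the action $f\mapsto f\circ h^{-1}$ of $h \in \langle g^k\rangle$ on $K(X)$ identifies $\langle g^k\rangle$ with $\mathrm{Gal}(K(X)/\pi_P^*K(\mathbb P^3))$. (2) The hypothesis on lines cannot be omitted. Let $d\ge 3$, let $\zeta\in K$ be a primitive $d(d-1)$-th root of unity, let $X\subset\mathbb P^4$ be the hypersurface $$X_0^d+X_1^d+X_2^d+X_0X_3^{d-1}+X_1X_4^{d-1}=0,$$ and let $g\in\mathrm{PGL}(5,K)$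 be the class of the diagonal matrix $\mathrm{diag}(\zeta^d,\zeta^d,\zeta,1,1)$. Then $X$ is smooth of degree $d$, $g$ is an automorphism of $X$ of order $d(d-1)$, and $\mathrm{Fix}(g)$ has codimension two in $X$ and contains a projective line, but there is no Galois point $P\in X$ such that $\langle g^d\rangle$ is the Galois group of the projection from $P$. -/

import Mathlib

open scoped LinearAlgebra.Projectivization MatrixGroups

namespace GaloisPoint

section

variable {K : Type*} [Field K] {m : ℕ}

/-- `F` is a form of degree `d` whose zero scheme in the projective space `ℙ K (Fin m → K)` is
smooth over the (algebraically closed) field `K`: the partial derivatives of `F` have no common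
zero on the hypersurface. -/
def IsSmoothHypersurface (F : MvPolynomial (Fin m) K) (d : ℕ) : Prop :=
  F.IsHomogeneous d ∧
    ∀ v : Fin m → K, v ≠ 0 → MvPolynomial.eval v F = 0 →
      ∃ i, MvPolynomial.eval v (MvPolynomial.pderiv i F) ≠ 0

/-- The set of points of the hypersurface `F = 0`, for a form `F`. -/
def hypersurface (F : MvPolynomial (Fin m) K) : Set (ℙ K (Fin m → K)) :=
  {p | MvPolynomial.eval p.rep F = 0}

/-- The projective transformation `g` maps the hypersurface `F = 0` onto itself. -/
def IsAutomorphism (F : MvPolynomial (Fin m) K) (g : PGL(Fin m, K)) : Prop :=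
  (fun p : ℙ K (Fin m → K) => g • p) '' hypersurface F = hypersurface F

/-- The fixed locus of `g` on the hypersurface `F = 0`. -/
def fixedLocus (F : MvPolynomial (Fin m) K) (g : PGL(Fin m, K)) : Set (ℙ K (Fin m → K)) :=
  {p | p ∈ hypersurface F ∧ g • p = p}

variable (K m) in
/-- The Zariski topology on projective space; the sets `f ≠ 0`, for forms `f`, are a basis. -/
@[reducible] def zariskiTopology : TopologicalSpace (ℙ K (Fin m → K)) :=
  TopologicalSpace.generateFrom
    {U | ∃ (n : ℕ) (f : MvPolynomial (Fin m) K), f.IsHomogeneous n ∧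
      U = {p | MvPolynomial.eval p.rep f ≠ 0}}

/-- The dimension of a subset of projective space: the Krull dimension of the subspace topology
induced by the Zariski topology (it is `⊥` for the empty set). -/
noncomputable def zariskiDim (Z : Set (ℙ K (Fin m → K))) : WithBot ℕ∞ :=
  letI := zariskiTopology K m
  topologicalKrullDim Z

/-- A subset `Z` of a hypersurface in the `(n + 1)`-dimensional projective space has codimension
`c` in that hypersurface, whose dimension is `n`. -/
def HasCodimInHypersurface {n : ℕ} (Z : Set (ℙ K (Fin (n + 2) → K))) (c : ℕ) : Prop :=
  zariskiDim Z + c = n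

/-- `Z` contains a projective line. -/
def ContainsLine (Z : Set (ℙ K (Fin m → K))) : Prop :=
  ∃ W : Submodule K (Fin m → K), Module.finrank K W = 2 ∧
    ∀ p : ℙ K (Fin m → K), p.submodule ≤ W → p ∈ Z

/-- The class of a polynomial in the total ring of fractions of the homogeneous coordinate ring
`K[X₀, …] / (F)`. -/
noncomputable def cls (F : MvPolynomial (Fin m) K) :
    MvPolynomial (Fin m) K →+* FractionRing (MvPolynomial (Fin m) K ⧸ Ideal.span {F}) :=
  (algebraMap (MvPolynomial (Fin m) K ⧸ Ideal.span {F}) _).comp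
    (Ideal.Quotient.mk (Ideal.span {F}))

theorem cls_eq_zero_iff (F a : MvPolynomial (Fin m) K) :
    cls F a = 0 ↔ a ∈ Ideal.span {F} := by
  unfold cls
  rw [RingHom.comp_apply, ← Ideal.Quotient.eq_zero_iff_mem]
  exact map_eq_zero_iff _ (IsFractionRing.injective _ _)

/-- The field of fractions `a / b` on the integral hypersurface `F = 0`, where `a` and `b` are
forms of the same degree that belong to the algebra `R` of polynomials, and `b` does not vanish
identically on the hypersurface. -/
noncomputable def ratioField (F : MvPolynomial (Fin m) K) [(Ideal.span {F}).IsPrime]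
    (R : Subalgebra K (MvPolynomial (Fin m) K)) :
    Subfield (FractionRing (MvPolynomial (Fin m) K ⧸ Ideal.span {F})) where
  carrier := {x | ∃ (n : ℕ) (a b : MvPolynomial (Fin m) K), a ∈ R ∧ b ∈ R ∧
    a.IsHomogeneous n ∧ b.IsHomogeneous n ∧ b ∉ Ideal.span {F} ∧ x = cls F a / cls F b}
  mul_mem' := by
    rintro _ _ ⟨n, a, b, ha, hb, han, hbn, hbF, rfl⟩ ⟨n', a', b', ha', hb', han', hbn', hbF', rfl⟩
    refine ⟨n + n', a * a', b * b', R.mul_mem ha ha', R.mul_mem hb hb', han.mul han',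
      hbn.mul hbn', fun h => ?_, ?_⟩
    · exact (Ideal.IsPrime.mem_or_mem ‹_› h).elim hbF hbF'
    · rw [map_mul, map_mul, div_mul_div_comm]
  one_mem' := by
    refine ⟨0, 1, 1, R.one_mem, R.one_mem, MvPolynomial.isHomogeneous_one _ _,
      MvPolynomial.isHomogeneous_one _ _, ?_, by simp⟩
    exact fun h => Ideal.IsPrime.ne_top ‹_› ((Ideal.eq_top_iff_one _).2 h)
  add_mem' := by
    rintro _ _ ⟨n, a, b, ha, hb, han, hbn, hbF, rfl⟩ ⟨n', a', b', ha', hb', han', hbn', hbF', rfl⟩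
    refine ⟨n + n', a * b' + b * a', b * b',
      R.add_mem (R.mul_mem ha hb') (R.mul_mem hb ha'), R.mul_mem hb hb',
      (han.mul hbn').add (hbn.mul han'), hbn.mul hbn', fun h => ?_, ?_⟩
    · exact (Ideal.IsPrime.mem_or_mem ‹_› h).elim hbF hbF'
    · rw [map_add, map_mul, map_mul, map_mul, div_add_div]
      · exact fun h => hbF ((cls_eq_zero_iff F b).1 h)
      · exact fun h => hbF' ((cls_eq_zero_iff F b').1 h)
  zero_mem' := by
    refine ⟨0, 0, 1, R.zero_mem, R.one_mem, MvPolynomial.isHomogeneous_zero _ _ _,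
      MvPolynomial.isHomogeneous_one _ _, ?_, by simp⟩
    exact fun h => Ideal.IsPrime.ne_top ‹_› ((Ideal.eq_top_iff_one _).2 h)
  neg_mem' := by
    rintro _ ⟨n, a, b, ha, hb, han, hbn, hbF, rfl⟩
    exact ⟨n, -a, b, R.neg_mem ha, hb, han.neg, hbn, hbF, by rw [map_neg, neg_div]⟩
  inv_mem' := by
    rintro _ ⟨n, a, b, ha, hb, han, hbn, hbF, rfl⟩
    by_cases haF : a ∈ Ideal.span {F}
    · refine ⟨0, 0, 1, R.zero_mem, R.one_mem, MvPolynomial.isHomogeneous_zero _ _ _,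
        MvPolynomial.isHomogeneous_one _ _, ?_, by simp [(cls_eq_zero_iff F a).2 haF]⟩
      exact fun h => Ideal.IsPrime.ne_top ‹_› ((Ideal.eq_top_iff_one _).2 h)
    · exact ⟨n, b, a, hb, ha, hbn, han, haF, by rw [inv_div]⟩

/-- The field of rational functions on the integral hypersurface `F = 0`. -/
noncomputable abbrev functionField (F : MvPolynomial (Fin m) K) [(Ideal.span {F}).IsPrime] :
    Subfield (FractionRing (MvPolynomial (Fin m) K ⧸ Ideal.span {F})) :=
  ratioField F ⊤

/-- The polynomials in the linear forms that vanish at the point `P`. These linear forms are the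
homogeneous coordinates of the target of the projection from `P`. -/
noncomputable def coneAlgebra (P : ℙ K (Fin m → K)) : Subalgebra K (MvPolynomial (Fin m) K) :=
  Algebra.adjoin K {l | l.IsHomogeneous 1 ∧ MvPolynomial.eval P.rep l = 0}

/-- The subfield of the function field of the hypersurface `F = 0` that consists of the pullbacks
of rational functions under the projection from the point `P`. -/
noncomputable def projectionField (F : MvPolynomial (Fin m) K) [(Ideal.span {F}).IsPrime]
    (P : ℙ K (Fin m → K)) : Subfield (functionField F) :=
  (ratioField F (coneAlgebra P)).comap (functionField F).subtype

/-- `P` is a Galois point: the hypersurface is integral, and the projection from `P` makes its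
function field a Galois extension of the function field of the target. -/
def IsGaloisPoint (F : MvPolynomial (Fin m) K) (P : ℙ K (Fin m → K)) : Prop :=
  ∃ _ : (Ideal.span {F}).IsPrime, IsGalois (projectionField F P) (functionField F)

/-- `φ` is the pullback of rational functions along the automorphism of the hypersurface `F = 0`
that the matrix `A` induces: `φ (a / b) = a(A X) / b(A X)`. -/
def IsPullback (F : MvPolynomial (Fin m) K) [(Ideal.span {F}).IsPrime] (A : GL (Fin m) K)
    (φ : functionField F → functionField F) : Prop :=
  ∀ (n : ℕ) (a b : MvPolynomial (Fin m) K) (x : functionField F),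
    a.IsHomogeneous n → b.IsHomogeneous n → b ∉ Ideal.span {F} →
    (x : FractionRing (MvPolynomial (Fin m) K ⧸ Ideal.span {F})) = cls F a / cls F b →
      MvPolynomial.bind₁ (A : Matrix (Fin m) (Fin m) K).toMvPolynomial b ∉ Ideal.span {F} ∧
      (φ x : FractionRing (MvPolynomial (Fin m) K ⧸ Ideal.span {F})) =
        cls F (MvPolynomial.bind₁ (A : Matrix (Fin m) (Fin m) K).toMvPolynomial a) /
          cls F (MvPolynomial.bind₁ (A : Matrix (Fin m) (Fin m) K).toMvPolynomial b)

/-- The group `G` of projective transformations is the Galois group of the projection of the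
hypersurface `F = 0` from `P`: letting `h ∈ G` act on rational functions by `f ↦ f ∘ h⁻¹`
identifies `G` with the group of automorphisms of the function field of the hypersurface over
the function field of the target. -/
def IsGaloisGroupOfProjection (F : MvPolynomial (Fin m) K) (P : ℙ K (Fin m → K))
    (G : Subgroup PGL(Fin m, K)) : Prop :=
  ∃ _ : (Ideal.span {F}).IsPrime,
    ∃ e : G ≃* (functionField F ≃ₐ[projectionField F P] functionField F),
      ∀ (h : G) (A : GL (Fin m) K), Matrix.ProjGenLinGroup.mk A = (h : PGL(Fin m, K))⁻¹ →
        IsPullback F A (e h)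

open MvPolynomial in
/-- The form `X₀ᵈ + X₁ᵈ + X₂ᵈ + X₀ X₃ᵈ⁻¹ + X₁ X₄ᵈ⁻¹`. -/
noncomputable def exampleForm (K : Type*) [Field K] (d : ℕ) : MvPolynomial (Fin 5) K :=
  X 0 ^ d + X 1 ^ d + X 2 ^ d + X 0 * X 3 ^ (d - 1) + X 1 * X 4 ^ (d - 1)

/-- The class of the diagonal matrix with entries `ζᵈ, ζᵈ, ζ, 1, 1`. -/
def exampleAut (d : ℕ) (ζ : Kˣ) : PGL(Fin 5, K) :=
  Matrix.ProjGenLinGroup.mk (Units.map (Matrix.diagonalRingHom (Fin 5) K).toMonoidHom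
    (MulEquiv.piUnits.symm ![ζ ^ d, ζ ^ d, ζ, 1, 1]))

end

end GaloisPoint

/-! Part (1). Put n = d - 1 and lift g to a matrix A. A power of A is scalar, so A is
diagonalizable, and Fix(g) is the union of the intersections of X with the projectivized
eigenspaces. If all eigenspaces had dimension at most 2, each intersection would be finite or a
whole line (`finite_fixedLocus`). Lines are excluded, so Fix(g) would have dimension at most 0, not
1. Hence some eigenspace has dimension at least 3, and after scaling A = diag(μ₀, μ₁, 1, 1, 1).

By the Nullstellensatz, F ∘ A = cF. Since X contains no line of fixed points, F has a monomial in
X₂, X₃, X₄ alone, so c = 1. Smoothness at the coordinate points gives monomials Xᵢⁿ Xⱼ, hence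
relations μᵢⁿ μⱼ = 1. Together with ord(g) = kn they force μ₀ᵏ = 1 or μ₁ᵏ = 1
(`pow_eq_one_or_pow_eq_one_of_orders`), so Aᵏ = diag(ω, 1, …, 1) up to reordering, with ω a
primitive n-th root of unity.

Invariance under this homology gives F = X₀ⁿ L + G with L, G free of X₀ (for d = 2 this form is
available at every point of the quadric). On X we have X₀ⁿ = -G/L, so projection from e₀ is a Kummer
extension with group generated by the homology (`exists_isGaloisPoint_of_homology`). The fixed field
is computed by hand: invariant rational functions are ratios of invariant forms, and in those X₀ⁿ
can be eliminated.

Part (2). Here gᵈ = diag(ζᵈ, ζᵈ, ζᵈ, 1, 1) is not a homology. For every P there are linear forms l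
in X₀, X₁ and l' in X₃, X₄ vanishing at P. Then l/l' comes from the target of the projection, yet gᵈ
multiplies it by ζᵈ ≠ 1. -/

namespace GaloisPoint

open MvPolynomial Matrix

/-! ### Linear substitutions in polynomials. -/

section LinearSubstitution

variable {K : Type*} [Field K] {m : ℕ}

/-- The linear substitution `p(X) ↦ p(A X)`. -/
noncomputable abbrev linSubst (A : Matrix (Fin m) (Fin m) K) :
    MvPolynomial (Fin m) K →ₐ[K] MvPolynomial (Fin m) K :=
  bind₁ A.toMvPolynomial

theorem eval_linSubst (A : Matrix (Fin m) (Fin m) K) (v : Fin m → K)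
    (p : MvPolynomial (Fin m) K) : eval v (linSubst A p) = eval (A *ᵥ v) p := by
  rw [linSubst, ← coe_aeval_eq_eval, RingHom.coe_coe, aeval_bind₁]
  simp only [← coe_aeval_eq_eval, RingHom.coe_coe]
  congr 2
  funext i
  rw [← toMvPolynomial_eval_eq_apply, ← coe_aeval_eq_eval, RingHom.coe_coe]

theorem linSubst_mul (A B : Matrix (Fin m) (Fin m) K) (p : MvPolynomial (Fin m) K) :
    linSubst (A * B) p = linSubst B (linSubst A p) := by
  simp only [linSubst, bind₁_bind₁]
  congr 2
  funext i
  exact toMvPolynomial_mul A B i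

theorem linSubst_one (p : MvPolynomial (Fin m) K) :
    linSubst (1 : Matrix (Fin m) (Fin m) K) p = p := by
  simp [linSubst]

theorem linSubst_inv_left (A : GL (Fin m) K) (p : MvPolynomial (Fin m) K) :
    linSubst (A : Matrix (Fin m) (Fin m) K) (linSubst (A⁻¹ : GL (Fin m) K).1 p) = p := by
  rw [← linSubst_mul, ← Units.val_mul, inv_mul_cancel, Units.val_one, linSubst_one]

theorem linSubst_inv_right (A : GL (Fin m) K) (p : MvPolynomial (Fin m) K) :
    linSubst (A⁻¹ : GL (Fin m) K).1 (linSubst (A : Matrix (Fin m) (Fin m) K) p) = p := by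
  rw [← linSubst_mul, ← Units.val_mul, mul_inv_cancel, Units.val_one, linSubst_one]

/-- An invertible linear substitution as an automorphism of the polynomial algebra. -/
noncomputable def linSubstEquiv (A : GL (Fin m) K) :
    MvPolynomial (Fin m) K ≃ₐ[K] MvPolynomial (Fin m) K :=
  AlgEquiv.ofAlgHom (linSubst A.1) (linSubst (A⁻¹ : GL (Fin m) K).1)
    (AlgHom.ext (linSubst_inv_left A)) (AlgHom.ext (linSubst_inv_right A))

@[simp]
theorem linSubstEquiv_apply (A : GL (Fin m) K) (p : MvPolynomial (Fin m) K) :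
    linSubstEquiv A p = linSubst A.1 p := rfl

theorem isHomogeneous_linSubst (A : Matrix (Fin m) (Fin m) K) {p : MvPolynomial (Fin m) K}
    {n : ℕ} (hp : p.IsHomogeneous n) : (linSubst A p).IsHomogeneous n := by
  have := hp.aeval A.toMvPolynomial (n := 1) (fun i => toMvPolynomial_isHomogeneous A i)
  simpa using this

theorem sum_eq_of_isHomogeneous {p : MvPolynomial (Fin m) K} {n : ℕ} (hp : p.IsHomogeneous n)
    {s : Fin m →₀ ℕ} (hs : coeff s p ≠ 0) : ∑ i, s i = n := by
  rw [hp.degree_eq_sum_deg_support (mem_support_iff.2 hs)]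
  exact (Finset.sum_subset (Finset.subset_univ _) (by simp)).symm

theorem toMvPolynomial_diagonal (μ : Fin m → K) :
    (diagonal μ).toMvPolynomial = fun i => C (μ i) * X i := by
  funext i
  rw [Matrix.toMvPolynomial, Finset.sum_eq_single i]
  · rw [diagonal_apply_eq, C_mul_X_eq_monomial]
  · intro j _ hj
    rw [diagonal_apply_ne' _ hj, monomial_zero]
  · simp

theorem linSubst_diagonal_X (μ : Fin m → K) (i : Fin m) :
    linSubst (diagonal μ) (X i) = C (μ i) * X i := by
  rw [linSubst, bind₁_X_right, toMvPolynomial_diagonal]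

/-- Monomials are eigenvectors of a diagonal substitution, so invariance of a form becomes a
condition on the exponents that occur in it. -/
theorem coeff_linSubst_diagonal (μ : Fin m → K) (p : MvPolynomial (Fin m) K)
    (s : Fin m →₀ ℕ) :
    coeff s (linSubst (diagonal μ) p) = (∏ i, μ i ^ s i) * coeff s p := by
  rw [linSubst, toMvPolynomial_diagonal]
  induction p using MvPolynomial.induction_on' with
  | add p q hp hq => simp [hp, hq, mul_add]
  | monomial t r =>
    have : bind₁ (fun i => C (μ i) * X i) (monomial t r) =
        monomial t ((∏ i, μ i ^ t i) * r) := by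
      rw [bind₁_monomial, ← Finsupp.prod, Finsupp.prod_fintype _ _ (by simp), monomial_eq,
        Finsupp.prod_fintype _ _ (by simp)]
      simp only [mul_pow, Finset.prod_mul_distrib, C_mul, map_prod, C_pow]
      ring
    rw [this, coeff_monomial, coeff_monomial]
    split_ifs with h
    · rw [h]
    · simp

theorem eval_smul_of_isHomogeneous {p : MvPolynomial (Fin m) K} {n : ℕ}
    (hp : p.IsHomogeneous n) (c : K) (v : Fin m → K) : eval (c • v) p = c ^ n * eval v p := by
  rw [eval_eq', eval_eq', Finset.mul_sum]
  refine Finset.sum_congr rfl fun s hs => ?_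
  have h := sum_eq_of_isHomogeneous hp (mem_support_iff.1 hs)
  simp only [Pi.smul_apply, smul_eq_mul, mul_pow, Finset.prod_mul_distrib,
    Finset.prod_pow_eq_pow_sum, h]
  ring

theorem linSubst_smul {p : MvPolynomial (Fin m) K} {n : ℕ} (hp : p.IsHomogeneous n) (c : K)
    (A : Matrix (Fin m) (Fin m) K) : linSubst (c • A) p = C (c ^ n) * linSubst A p := by
  have h1 : linSubst (diagonal fun _ => c) p = C (c ^ n) * p := by
    ext s
    rw [coeff_linSubst_diagonal, coeff_C_mul]
    by_cases hs : coeff s p = 0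
    · simp [hs]
    · have h := sum_eq_of_isHomogeneous hp hs
      rw [Finset.prod_pow_eq_pow_sum, h]
  rw [show c • A = (diagonal fun _ => c) * A by ext; simp, linSubst_mul, h1, map_mul]
  simp [linSubst]

theorem pderiv_linSubst (A : Matrix (Fin m) (Fin m) K) (i : Fin m)
    (p : MvPolynomial (Fin m) K) :
    pderiv i (linSubst A p) = ∑ j, C (A j i) * linSubst A (pderiv j p) := by
  have hX : ∀ j, pderiv i (A.toMvPolynomial j) = C (A j i) := by
    intro j
    rw [Matrix.toMvPolynomial, map_sum, Finset.sum_eq_single i]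
    · rw [← C_mul_X_eq_monomial, pderiv_C_mul, pderiv_X_self, mul_one]
    · intro k _ hk
      rw [← C_mul_X_eq_monomial, pderiv_C_mul, pderiv_X_of_ne hk, mul_zero]
    · simp
  induction p using MvPolynomial.induction_on with
  | C a => simp [linSubst]
  | add p q hp hq => simp only [map_add, hp, hq, mul_add, Finset.sum_add_distrib]
  | mul_X p k hp =>
    simp only [map_mul, pderiv_mul, hp, map_add, mul_add, Finset.sum_add_distrib]
    have e : linSubst A (X k) = A.toMvPolynomial k := bind₁_X_right _ _
    rw [e, hX, Finset.sum_mul]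
    congr 1
    · exact Finset.sum_congr rfl fun j _ => mul_assoc _ _ _
    · rw [Finset.sum_eq_single k]
      · rw [pderiv_X_self, map_one]; ring
      · intro j _ hj
        rw [pderiv_X_of_ne hj.symm, map_zero]; ring
      · simp

end LinearSubstitution

/-! ### Consequences of smoothness. -/

section Smooth

variable {K : Type*} [Field K] {m : ℕ}

theorem IsSmoothHypersurface.ne_zero {F : MvPolynomial (Fin (m + 1)) K} {d : ℕ}
    (hF : IsSmoothHypersurface F d) : F ≠ 0 := by
  rintro rfl
  obtain ⟨i, hi⟩ := hF.2 (fun _ => 1) (fun h => one_ne_zero (congrFun h 0)) (map_zero _)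
  simp at hi

/-- By the chain rule the gradient of F ∘ T at v is the gradient of F at Tv times T, and T is
invertible. -/
theorem IsSmoothHypersurface.linSubst {F : MvPolynomial (Fin m) K} {d : ℕ}
    (hF : IsSmoothHypersurface F d) (T : GL (Fin m) K) :
    IsSmoothHypersurface (linSubst T.1 F) d := by
  refine ⟨isHomogeneous_linSubst _ hF.1, fun v hv h => ?_⟩
  by_contra! hall
  rw [eval_linSubst] at h
  have hTv : T.1 *ᵥ v ≠ 0 := fun h0 => hv (by
    have := congrArg (fun w => (T⁻¹ : GL (Fin m) K).1 *ᵥ w) h0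
    simpa [Matrix.mulVec_mulVec, ← Units.val_mul] using this)
  obtain ⟨j, hj⟩ := hF.2 _ hTv h
  let w : Fin m → K := fun j => eval (T.1 *ᵥ v) (pderiv j F)
  have hw : w ᵥ* T.1 = 0 := by
    funext i
    have := hall i
    rw [pderiv_linSubst, map_sum] at this
    simp only [map_mul, eval_C, eval_linSubst] at this
    rw [Pi.zero_apply, ← this]
    simp only [vecMul, dotProduct, w, mul_comm]
  have : w = 0 := by
    have := congrArg (fun u => u ᵥ* (T⁻¹ : GL (Fin m) K).1) hw
    simpa [Matrix.vecMul_vecMul, ← Units.val_mul] using this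
  exact hj (congrFun this j)

theorem IsSmoothHypersurface.not_eval_eq_zero_of_eq_mul {F a b : MvPolynomial (Fin m) K} {d : ℕ}
    (hF : IsSmoothHypersurface F d) (h : F = a * b) {v : Fin m → K} (hv : v ≠ 0)
    (ha : eval v a = 0) : eval v b ≠ 0 := by
  intro hb
  obtain ⟨i, hi⟩ := hF.2 v hv (by rw [h, map_mul, ha, zero_mul])
  rw [h, pderiv_mul, map_add, map_mul, map_mul, ha, hb] at hi
  simp at hi

theorem eval_single_one {p : MvPolynomial (Fin m) K} {e : ℕ} (hp : p.IsHomogeneous e)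
    (i : Fin m) : eval (Pi.single i 1) p = coeff (Finsupp.single i e) p := by
  rw [eval_eq']
  have hs : ∀ s ∈ p.support, s ≠ Finsupp.single i e →
      coeff s p * ∏ j, (Pi.single i 1 : Fin m → K) j ^ s j = 0 := by
    intro s hs hne
    have hdeg := hp.degree_eq_sum_deg_support hs
    have : ∃ j, j ≠ i ∧ s j ≠ 0 := by
      by_contra! hall
      apply hne
      ext j
      rw [Finsupp.single_apply]
      split_ifs with hij
      · subst hij
        rw [hdeg, Finset.sum_subset (Finset.subset_univ _) (by simp),
          Finset.sum_eq_single i (fun k _ hk => hall k hk) (by simp)]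
      · exact hall j (Ne.symm hij)
    obtain ⟨j, hj, hsj⟩ := this
    rw [Finset.prod_eq_zero (Finset.mem_univ j), mul_zero]
    rw [Pi.single_eq_of_ne hj, zero_pow hsj]
  rw [Finset.sum_eq_single (Finsupp.single i e) hs]
  · rw [Finset.prod_eq_one, mul_one]
    intro j _
    by_cases hj : j = i
    · subst hj; simp
    · rw [Finsupp.single_eq_of_ne hj, pow_zero]
  · intro h
    rw [notMem_support_iff.1 h, zero_mul]

/-- At the coordinate point eᵢ, the values of F and of its partial derivatives are, up to integer
factors, the coefficients of the monomials Xᵢⁿ Xⱼ. If all vanished, eᵢ would be a singular point. -/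
theorem IsSmoothHypersurface.exists_coeff_ne_zero {F : MvPolynomial (Fin m) K} {n : ℕ}
    (hF : IsSmoothHypersurface F (n + 1)) (i : Fin m) :
    ∃ j, coeff (Finsupp.single i n + Finsupp.single j 1) F ≠ 0 := by
  by_contra! hall
  have h0 : eval (Pi.single i 1) F = 0 := by
    rw [eval_single_one hF.1, Finsupp.single_add, hall]
  obtain ⟨j, hj⟩ := hF.2 (Pi.single i 1) (by simp) h0
  rw [eval_single_one (hF.1.pderiv), coeff_pderiv] at hj
  simp [hall] at hj

end Smooth

/-! ### Nullstellensatz and squarefreeness. -/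

section Nullstellensatz

variable {K : Type*} [Field K] [IsAlgClosed K] {m : ℕ}

theorem exists_dvd_pow_of_forall_eval_eq_zero {F H : MvPolynomial (Fin m) K}
    (h : ∀ v, eval v F = 0 → eval v H = 0) : ∃ n : ℕ, F ∣ H ^ n := by
  have : H ∈ (Ideal.span {F}).radical := by
    rw [← vanishingIdeal_zeroLocus_eq_radical (K := K)]
    intro x hx
    rw [zeroLocus_span] at hx
    have hx' := hx F rfl
    rw [aeval_eq_eval] at hx' ⊢
    exact h x hx'
  obtain ⟨n, hn⟩ := this
  exact ⟨n, Ideal.mem_span_singleton.1 hn⟩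

/-- Without a nonzero zero, F would divide powers of both X₀ and X₁, hence be a unit. Two variables
are needed. -/
theorem exists_ne_zero_eval_eq_zero {F : MvPolynomial (Fin (m + 2)) K} (hF : ¬ IsUnit F) :
    ∃ v, v ≠ 0 ∧ eval v F = 0 := by
  by_contra! hall
  have key : ∀ i, ∃ n : ℕ, F ∣ X i ^ n := fun i =>
    exists_dvd_pow_of_forall_eval_eq_zero fun v hv => by
      have : v = 0 := by
        by_contra h
        exact hall v h hv
      simp [this]
  obtain ⟨a, ha⟩ := key 0
  obtain ⟨b, hb⟩ := key 1
  obtain ⟨i, -, hi⟩ := (dvd_prime_pow (X_prime (R := K) (i := (0 : Fin (m + 2)))) a).1 ha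
  have hdvd : (X 0 : MvPolynomial (Fin (m + 2)) K) ^ i ∣ X 1 ^ b := hi.symm.dvd.trans hb
  rcases Nat.eq_zero_or_pos i with h0 | h0
  · rw [h0, pow_zero] at hi
    exact hF (associated_one_iff_isUnit.1 hi)
  · have := (X_prime (R := K) (i := (0 : Fin (m + 2)))).dvd_of_dvd_pow ((dvd_pow_self _ h0.ne').trans hdvd)
    rw [X_dvd_X] at this
    simp at this

/-- Any zero of a repeated factor is a singular point. -/
theorem IsSmoothHypersurface.squarefree {F : MvPolynomial (Fin (m + 2)) K} {d : ℕ}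
    (hF : IsSmoothHypersurface F d) : Squarefree F := by
  intro G hG
  by_contra hu
  obtain ⟨v, hv, h0⟩ := exists_ne_zero_eval_eq_zero hu
  obtain ⟨H, hH⟩ := hG
  rw [mul_assoc] at hH
  exact hF.not_eval_eq_zero_of_eq_mul hH hv h0 (by rw [map_mul, h0, zero_mul])

end Nullstellensatz

/-! ### Projective transformations preserving a hypersurface. -/

section Projective

variable {K : Type*} [Field K] {m : ℕ}

theorem mk_mem_hypersurface {F : MvPolynomial (Fin m) K} {d : ℕ} (hF : F.IsHomogeneous d)
    {v : Fin m → K} (hv : v ≠ 0) :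
    Projectivization.mk K v hv ∈ hypersurface F ↔ eval v F = 0 := by
  obtain ⟨a, ha⟩ := Projectivization.exists_smul_eq_mk_rep K v hv
  rw [hypersurface, Set.mem_ofPred_eq, ← ha, Units.smul_def, eval_smul_of_isHomogeneous hF]
  simp

theorem mk_smul_eq_mk_rep (A : GL (Fin m) K) (p : ℙ K (Fin m → K)) (h : A.1 *ᵥ p.rep ≠ 0) :
    ProjGenLinGroup.mk A • p = Projectivization.mk K (A.1 *ᵥ p.rep) h := by
  conv_lhs => rw [← p.mk_rep]
  rfl

theorem mulVec_ne_zero (A : GL (Fin m) K) {v : Fin m → K} (hv : v ≠ 0) : A.1 *ᵥ v ≠ 0 :=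
  fun h0 => hv (by
    have := congrArg (fun w => (A⁻¹ : GL (Fin m) K).1 *ᵥ w) h0
    simpa [Matrix.mulVec_mulVec, ← Units.val_mul] using this)

theorem mk_smul_eq_self_iff (A : GL (Fin m) K) (p : ℙ K (Fin m → K)) :
    ProjGenLinGroup.mk A • p = p ↔ ∃ c : K, A.1 *ᵥ p.rep = c • p.rep := by
  rw [mk_smul_eq_mk_rep A p (mulVec_ne_zero A p.rep_nonzero)]
  conv_lhs => rhs; rw [← p.mk_rep]
  rw [Projectivization.mk_eq_mk_iff']
  exact ⟨fun ⟨a, ha⟩ => ⟨a, ha.symm⟩, fun ⟨a, ha⟩ => ⟨a, ha.symm⟩⟩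

theorem IsAutomorphism.eval_mulVec_eq_zero {F : MvPolynomial (Fin m) K} {d : ℕ}
    (hF : F.IsHomogeneous d) {A : GL (Fin m) K}
    (hA : IsAutomorphism F (ProjGenLinGroup.mk A)) {v : Fin m → K} (hv : eval v F = 0) :
    eval (A.1 *ᵥ v) F = 0 := by
  by_cases h0 : v = 0
  · rw [h0, mulVec_zero, ← h0, hv]
  · have h1 := (mk_mem_hypersurface hF h0).2 hv
    have h2 : ProjGenLinGroup.mk A • Projectivization.mk K v h0 ∈ hypersurface F := by
      rw [← hA]; exact ⟨_, h1, rfl⟩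
    exact (mk_mem_hypersurface hF (mulVec_ne_zero A h0)).1 h2

/-- F ∘ A vanishes wherever F does, and F is squarefree, so F divides F ∘ A. The degrees agree, so
the quotient is constant. -/
theorem IsAutomorphism.exists_linSubst_eq [IsAlgClosed K] {F : MvPolynomial (Fin (m + 2)) K}
    {d : ℕ} (hF : IsSmoothHypersurface F d) {A : GL (Fin (m + 2)) K}
    (hA : IsAutomorphism F (ProjGenLinGroup.mk A)) :
    ∃ c : K, linSubst A.1 F = C c * F := by
  obtain ⟨n, hn⟩ := exists_dvd_pow_of_forall_eval_eq_zero (F := F) (H := linSubst A.1 F)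
    fun v hv => by rw [eval_linSubst]; exact hA.eval_mulVec_eq_zero hF.1 hv
  have hr : IsRadical F := (isRadical_iff_squarefree_of_ne_zero hF.ne_zero).2 hF.squarefree
  obtain ⟨Q, hQ⟩ := hr n _ hn
  have hAF : linSubst A.1 F ≠ 0 := fun h => hF.ne_zero (by
    have := (linSubstEquiv A).injective (a₁ := F) (a₂ := 0)
    exact this (by simpa using h))
  have hQ0 : Q ≠ 0 := by rintro rfl; simp [hQ] at hAF
  have hdeg : Q.totalDegree = 0 := by
    have h1 := (isHomogeneous_linSubst A.1 hF.1).totalDegree hAF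
    rw [hQ, totalDegree_mul_of_isDomain hF.ne_zero hQ0, hF.1.totalDegree hF.ne_zero] at h1
    omega
  rw [totalDegree_eq_zero_iff_eq_C] at hdeg
  exact ⟨coeff 0 Q, by rw [hQ, mul_comm, ← hdeg]⟩

end Projective

/-! ### Pullback action on the function field. -/

section Pullback

variable {K : Type*} [Field K] {m : ℕ} {F : MvPolynomial (Fin m) K}

theorem linSubst_inv_eq {A : GL (Fin m) K} {c : K} (hc : c ≠ 0)
    (hA : linSubst A.1 F = C c * F) : linSubst (A⁻¹ : GL (Fin m) K).1 F = C c⁻¹ * F := by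
  have h := linSubst_inv_right A F
  rw [hA, map_mul] at h
  have hC : linSubst (A⁻¹ : GL (Fin m) K).1 (C c) = C c := by simp [linSubst]
  rw [hC] at h
  conv_rhs => rw [← h]
  rw [← mul_assoc, ← C_mul, inv_mul_cancel₀ hc, C_1, one_mul]

theorem linSubst_mem_span {A : GL (Fin m) K} {c : K} (hA : linSubst A.1 F = C c * F)
    {b : MvPolynomial (Fin m) K} (hb : b ∈ Ideal.span {F}) :
    linSubst A.1 b ∈ Ideal.span {F} := by
  obtain ⟨q, rfl⟩ := Ideal.mem_span_singleton.1 hb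
  rw [Ideal.mem_span_singleton, map_mul, hA]
  exact ⟨C c * linSubst A.1 q, by ring⟩

theorem linSubst_mem_span_iff {A : GL (Fin m) K} {c : K} (hc : c ≠ 0)
    (hA : linSubst A.1 F = C c * F) {b : MvPolynomial (Fin m) K} :
    linSubst A.1 b ∈ Ideal.span {F} ↔ b ∈ Ideal.span {F} := by
  refine ⟨fun h => ?_, linSubst_mem_span hA⟩
  have := linSubst_mem_span (linSubst_inv_eq hc hA) h
  rwa [linSubst_inv_right] at this

theorem cls_ne_zero {b : MvPolynomial (Fin m) K} (hb : b ∉ Ideal.span {F}) : cls F b ≠ 0 :=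
  fun h => hb ((cls_eq_zero_iff F b).1 h)

theorem cls_eq_cls_iff {a b : MvPolynomial (Fin m) K} :
    cls F a = cls F b ↔ a - b ∈ Ideal.span {F} := by
  rw [← cls_eq_zero_iff, map_sub, sub_eq_zero]

variable [(Ideal.span {F}).IsPrime]

/-- The substitution followed by `cls F` has kernel exactly (F), so it descends to an injection of
the coordinate ring and extends to fractions. -/
theorem exists_fractionRing_hom {A : GL (Fin m) K} {c : K} (hc : c ≠ 0)
    (hA : linSubst A.1 F = C c * F) :
    ∃ Φ : FractionRing (MvPolynomial (Fin m) K ⧸ Ideal.span {F}) →+*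
        FractionRing (MvPolynomial (Fin m) K ⧸ Ideal.span {F}),
      ∀ a, Φ (cls F a) = cls F (linSubst A.1 a) := by
  let f : MvPolynomial (Fin m) K →+* FractionRing (MvPolynomial (Fin m) K ⧸ Ideal.span {F}) :=
    (cls F).comp (linSubst A.1).toRingHom
  have hf : ∀ a, f a = cls F (linSubst A.1 a) := fun a => rfl
  have hker : ∀ a, f a = 0 ↔ a ∈ Ideal.span {F} := fun a => by
    rw [hf, cls_eq_zero_iff, linSubst_mem_span_iff hc hA]
  let f' : (MvPolynomial (Fin m) K ⧸ Ideal.span {F}) →+*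
      FractionRing (MvPolynomial (Fin m) K ⧸ Ideal.span {F}) :=
    Ideal.Quotient.lift _ f fun a ha => (hker a).2 ha
  have hinj : Function.Injective f' := by
    rw [injective_iff_map_eq_zero]
    intro x hx
    obtain ⟨a, rfl⟩ := Ideal.Quotient.mk_surjective x
    rw [Ideal.Quotient.lift_mk, hker] at hx
    exact Ideal.Quotient.eq_zero_iff_mem.2 hx
  refine ⟨IsFractionRing.lift hinj, fun a => ?_⟩
  rw [cls, RingHom.comp_apply, IsFractionRing.lift_algebraMap, Ideal.Quotient.lift_mk, hf]
  rfl

theorem exists_isPullback {A : GL (Fin m) K} {c : K} (hc : c ≠ 0)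
    (hA : linSubst A.1 F = C c * F) :
    ∃ φ : functionField F →+* functionField F, IsPullback F A φ := by
  obtain ⟨Φ, hΦ⟩ := exists_fractionRing_hom hc hA
  have hmem : ∀ x : functionField F, Φ x.1 ∈ functionField F := by
    rintro ⟨_, n, a, b, -, -, ha, hb, hbF, rfl⟩
    refine ⟨n, linSubst A.1 a, linSubst A.1 b, Algebra.mem_top, Algebra.mem_top,
      isHomogeneous_linSubst _ ha, isHomogeneous_linSubst _ hb, ?_, ?_⟩
    · rwa [linSubst_mem_span_iff hc hA]
    · simp only [map_div₀, hΦ]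
  refine ⟨(Φ.comp (functionField F).subtype).codRestrict (functionField F) hmem, ?_⟩
  intro n a b x ha hb hbF hx
  refine ⟨by rwa [linSubst_mem_span_iff hc hA], ?_⟩
  change Φ x.1 = _
  rw [hx, map_div₀, hΦ, hΦ]

theorem IsPullback.ext {A : GL (Fin m) K} {φ ψ : functionField F → functionField F}
    (hφ : IsPullback F A φ) (hψ : IsPullback F A ψ) (x : functionField F) : φ x = ψ x := by
  obtain ⟨n, a, b, -, -, ha, hb, hbF, hx⟩ := x.2
  exact Subtype.ext (((hφ n a b x ha hb hbF hx).2).trans ((hψ n a b x ha hb hbF hx).2).symm)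

theorem IsPullback.comp {A B : GL (Fin m) K} {φ ψ : functionField F → functionField F}
    (hφ : IsPullback F A φ) (hψ : IsPullback F B ψ) : IsPullback F (A * B) (ψ ∘ φ) := by
  intro n a b x ha hb hbF hx
  obtain ⟨h1, h2⟩ := hφ n a b x ha hb hbF hx
  obtain ⟨h3, h4⟩ := hψ n _ _ (φ x) (isHomogeneous_linSubst A.1 ha)
    (isHomogeneous_linSubst A.1 hb) h1 h2
  rw [Units.val_mul]
  change linSubst _ _ ∉ _ ∧ _ = cls F (linSubst _ _) / cls F (linSubst _ _)
  rw [linSubst_mul, linSubst_mul]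
  exact ⟨h3, h4⟩

/-- Scaling the matrix by u multiplies numerator and denominator by the same uⁿ, so the pullback
depends only on the class in PGL. -/
theorem IsPullback.of_mk_eq_mk {A B : GL (Fin m) K} {φ : functionField F → functionField F}
    (hφ : IsPullback F A φ) (h : ProjGenLinGroup.mk A = ProjGenLinGroup.mk B) :
    IsPullback F B φ := by
  obtain ⟨u, rfl⟩ := ProjGenLinGroup.mk_eq_mk_iff.1 h
  have hu : (A * GeneralLinearGroup.scalar (Fin m) u : GL (Fin m) K).1 = (u : K) • A.1 := by
    ext i j
    simp [Matrix.mul_apply, Matrix.scalar_apply, Matrix.diagonal_apply, mul_comm]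
  intro n a b x ha hb hbF hx
  obtain ⟨h1, h2⟩ := hφ n a b x ha hb hbF hx
  rw [hu]
  change linSubst _ _ ∉ _ ∧ _ = cls F (linSubst _ _) / cls F (linSubst _ _)
  rw [linSubst_smul ha, linSubst_smul hb]
  have hc : (u : K) ^ n ≠ 0 := pow_ne_zero _ u.ne_zero
  have hcF : (C ((u : K) ^ n) : MvPolynomial (Fin m) K) ∉ Ideal.span {F} := fun hmem =>
    Ideal.IsPrime.ne_top ‹_› (Ideal.eq_top_of_isUnit_mem _ hmem ((IsUnit.mk0 _ hc).map C))
  refine ⟨fun hmem => (Ideal.IsPrime.mem_or_mem ‹_› hmem).elim hcF h1, ?_⟩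
  rw [h2, map_mul, map_mul, mul_div_mul_left _ _ (cls_ne_zero hcF)]

theorem isPullback_one : IsPullback F 1 id := by
  intro n a b x ha hb hbF hx
  change linSubst 1 _ ∉ _ ∧ _ = cls F (linSubst 1 _) / cls F (linSubst 1 _)
  rw [linSubst_one, linSubst_one]
  exact ⟨hbF, hx⟩

theorem exists_pullback_monoidHom (G : Subgroup PGL(Fin m, K))
    (hG : ∀ h ∈ G, ∃ (A : GL (Fin m) K) (c : K), ProjGenLinGroup.mk A = h ∧ c ≠ 0 ∧
      linSubst A.1 F = C c * F) :
    ∃ ρ : G →* (functionField F →+* functionField F),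
      ∀ (h : G) (A : GL (Fin m) K), ProjGenLinGroup.mk A = (h : PGL(Fin m, K))⁻¹ →
        IsPullback F A (ρ h) := by
  have key : ∀ h : G, ∃ φ : functionField F →+* functionField F,
      ∀ A : GL (Fin m) K, ProjGenLinGroup.mk A = (h : PGL(Fin m, K))⁻¹ → IsPullback F A φ := by
    intro h
    obtain ⟨A, c, hAh, hc, hA⟩ := hG _ (G.inv_mem h.2)
    obtain ⟨φ, hφ⟩ := exists_isPullback hc hA
    exact ⟨φ, fun B hB => hφ.of_mk_eq_mk (hAh.trans hB.symm)⟩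
  choose ρ hρ using key
  refine ⟨{ toFun := ρ, map_one' := ?_, map_mul' := ?_ }, hρ⟩
  · ext1 x
    exact (hρ 1 1 (by simp)).ext isPullback_one x
  · intro h₁ h₂
    ext1 x
    obtain ⟨A₁, hA₁⟩ := ProjGenLinGroup.mk_surjective (h₁ : PGL(Fin m, K))⁻¹
    obtain ⟨A₂, hA₂⟩ := ProjGenLinGroup.mk_surjective (h₂ : PGL(Fin m, K))⁻¹
    -- Pullback reverses products, and so does inversion; together they make ρ a homomorphism.
    exact (hρ (h₁ * h₂) (A₂ * A₁) (by rw [map_mul, hA₁, hA₂]; simp)).ext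
      ((hρ h₂ A₂ hA₂).comp (hρ h₁ A₁ hA₁)) x

/-- Artin's theorem: a finite group acting faithfully is the Galois group over its fixed field. What
remains is to identify that field with `projectionField F P`. -/
theorem isGaloisGroupOfProjection_of_fixed {P : ℙ K (Fin m → K)} {G : Subgroup PGL(Fin m, K)}
    [Finite G] {ρ : G →* (functionField F →+* functionField F)}
    (hρ : ∀ (h : G) (A : GL (Fin m) K), ProjGenLinGroup.mk A = (h : PGL(Fin m, K))⁻¹ →
        IsPullback F A (ρ h))
    (hfaithful : ∀ h, (∀ x, ρ h x = x) → h = 1)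
    (hfixed : ∀ h, ∀ x ∈ projectionField F P, ρ h x = x)
    (hinv : ∀ x, (∀ h, ρ h x = x) → x ∈ projectionField F P) :
    IsGaloisPoint F P ∧ IsGaloisGroupOfProjection F P G := by
  let : MulSemiringAction G (functionField F) := MulSemiringAction.compHom _ ρ
  have hsmul : ∀ (h : G) (x : functionField F), h • x = ρ h x := fun _ _ => rfl
  have : IsGaloisGroup G (projectionField F P) (functionField F) :=
    { faithful := ⟨fun {h₁ h₂} hh => by
        have : h₂⁻¹ * h₁ = 1 := hfaithful _ fun x => by
          rw [← hsmul, mul_smul, hh x, inv_smul_smul]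
        exact (inv_mul_eq_one.1 this).symm⟩
      commutes := ⟨fun h r x => by
        rw [Algebra.smul_def, Algebra.smul_def, smul_mul', hsmul h (algebraMap _ _ r)]
        rw [show algebraMap (projectionField F P) (functionField F) r = r.1 from rfl, hfixed h _ r.2]⟩
      isInvariant := ⟨fun x hx => ⟨⟨x, hinv x fun h => hx h⟩, rfl⟩⟩ }
  refine ⟨⟨inferInstance, IsGaloisGroup.isGalois G _ _⟩, inferInstance,
    IsGaloisGroup.mulEquivAlgEquiv G (projectionField F P) (functionField F), fun h A hA => ?_⟩
  have := hρ h A hA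
  convert this using 1
  funext x
  simp [hsmul]

end Pullback

/-! ### Forms X₀ⁿ L + G: irreducibility and elimination of X₀. -/

/-- The leading coefficient a is prime, so one factor has unit leading coefficient and keeps its
degree modulo a. There the product is the nonzero constant b, so that factor has degree 0 and is a
unit. -/
theorem irreducible_C_mul_X_pow_add_C {R : Type*} [CommRing R] [IsDomain R] {a b : R}
    (ha : Prime a) (hab : ¬ a ∣ b) {n : ℕ} (hn : n ≠ 0) :
    Irreducible (Polynomial.C a * Polynomial.X ^ n + Polynomial.C b) := by
  set p := Polynomial.C a * Polynomial.X ^ n + Polynomial.C b with hp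
  have hdeg : p.natDegree = n := by
    rw [hp, Polynomial.natDegree_add_C, Polynomial.natDegree_C_mul_X_pow _ _ ha.ne_zero]
  have hlead : p.leadingCoeff = a := by
    rw [Polynomial.leadingCoeff, hdeg, hp]
    simp [Polynomial.coeff_C, hn]
  have key : ∀ f g : Polynomial R, p = f * g → IsUnit g.leadingCoeff → IsUnit g := by
    intro f g hfg hu
    have : (Ideal.span {a}).IsPrime := (Ideal.span_singleton_prime ha.ne_zero).2 ha
    let π := Ideal.Quotient.mk (Ideal.span {a})
    have hb : π b ≠ 0 := by
      rwa [Ne, Ideal.Quotient.eq_zero_iff_mem, Ideal.mem_span_singleton]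
    have hmap : f.map π * g.map π = Polynomial.C (π b) := by
      have ha0 : π a = 0 := Ideal.Quotient.eq_zero_iff_mem.2 (Ideal.mem_span_singleton_self a)
      rw [← Polynomial.map_mul, ← hfg, hp]
      simp [ha0]
    have hg : (g.map π).natDegree = g.natDegree :=
      Polynomial.natDegree_map_of_leadingCoeff_ne_zero _ (hu.map π).ne_zero
    have h0 : f.map π * g.map π ≠ 0 := by
      rw [hmap]; simpa using hb
    have hsum := Polynomial.natDegree_mul (left_ne_zero_of_mul h0) (right_ne_zero_of_mul h0)
    rw [hmap, Polynomial.natDegree_C] at hsum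
    rw [Polynomial.eq_C_of_natDegree_eq_zero (p := g) (by omega)]
    rw [Polynomial.leadingCoeff, show g.natDegree = 0 by omega] at hu
    exact hu.map Polynomial.C
  refine ⟨fun hu => hn (hdeg ▸ Polynomial.natDegree_eq_zero_of_isUnit hu), fun f g hfg => ?_⟩
  have hl : a = f.leadingCoeff * g.leadingCoeff := by
    rw [← hlead, hfg, Polynomial.leadingCoeff_mul]
  rcases ha.irreducible.isUnit_or_isUnit hl with h | h
  · exact Or.inl (key g f (by rw [hfg, mul_comm]) h)
  · exact Or.inr (key f g hfg h)

section MonoidalForm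

variable {K : Type*} [Field K] {r n : ℕ}

theorem finSuccEquiv_rename_succ (q : MvPolynomial (Fin r) K) :
    finSuccEquiv K r (rename Fin.succ q) = Polynomial.C q := by
  induction q using MvPolynomial.induction_on with
  | C a => simp [finSuccEquiv_apply]
  | add p q hp hq => simp [hp, hq]
  | mul_X p i hp => rw [map_mul, map_mul, hp, rename_X, finSuccEquiv_X_succ, ← map_mul]

theorem irreducible_of_isHomogeneous_one {L : MvPolynomial (Fin r) K} (hL : L.IsHomogeneous 1)
    (h0 : L ≠ 0) : Irreducible L := by
  refine irreducible_of_totalDegree_eq_one (hL.totalDegree h0) fun x hx => ?_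
  obtain ⟨s, hs⟩ := ne_zero_iff.1 h0
  exact isUnit_iff_ne_zero.2 fun hx0 => hs (by simpa [hx0] using hx s)

/-- A smooth form of degree `n + 1` whose monomials have degree `0` or `n` in `X₀` is
`X₀ⁿ L + G` with `L` and `G` free of `X₀`. -/
theorem exists_eq_X_pow_mul_add {F : MvPolynomial (Fin (r + 1)) K} (hn : n ≠ 0)
    (hF : IsSmoothHypersurface F (n + 1))
    (hs : ∀ s, coeff s F ≠ 0 → s 0 = 0 ∨ s 0 = n) :
    ∃ L G : MvPolynomial (Fin r) K, L.IsHomogeneous 1 ∧ L ≠ 0 ∧ G.IsHomogeneous (n + 1) ∧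
      F = X 0 ^ n * rename Fin.succ L + rename Fin.succ G := by
  refine ⟨(finSuccEquiv K r F).coeff n, (finSuccEquiv K r F).coeff 0,
    hF.1.finSuccEquiv_coeff_isHomogeneous n 1 rfl,
    ?_, hF.1.finSuccEquiv_coeff_isHomogeneous 0 (n + 1) (zero_add _), ?_⟩
  · obtain ⟨j, hj⟩ := hF.exists_coeff_ne_zero (0 : Fin (r + 1))
    have hj0 : j ≠ 0 := by
      rintro rfl
      have := hs _ hj
      simp at this
    obtain ⟨i, rfl⟩ := Fin.exists_succ_eq.2 hj0
    intro h0
    have h1 := finSuccEquiv_coeff_coeff (Finsupp.single i 1) F n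
    rw [h0, coeff_zero] at h1
    apply hj
    rw [h1]
    congr 1
    ext k
    refine Fin.cases ?_ (fun k => ?_) k
    · simp
    · simp [Finsupp.single_apply]
  · apply (finSuccEquiv K r).injective
    rw [map_add, map_mul, map_pow, finSuccEquiv_X_zero, finSuccEquiv_rename_succ,
      finSuccEquiv_rename_succ]
    ext i s
    simp only [Polynomial.coeff_add, Polynomial.coeff_C, mul_comm (Polynomial.X ^ n),
      Polynomial.coeff_C_mul_X_pow]
    by_cases h0 : i = 0
    · subst h0
      simp [hn.symm]
    · by_cases h1 : i = n
      · subst h1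
        simp [h0]
      · simp only [h0, h1, if_false, add_zero, coeff_zero]
        rw [finSuccEquiv_coeff_coeff]
        by_contra h
        have := hs _ h
        simp [h0, h1] at this

/-- If G = LQ then F = L (X₀ⁿ + Q). Over a nonzero zero w of L, solving xⁿ = -Q(w) gives a common
zero of both factors, which is a singular point. -/
theorem not_dvd_of_smooth [IsAlgClosed K] {L G : MvPolynomial (Fin (r + 2)) K} (hn : n ≠ 0)
    (hL : L.IsHomogeneous 1) (hL0 : L ≠ 0) {d : ℕ}
    (hF : IsSmoothHypersurface (X 0 ^ n * rename Fin.succ L + rename Fin.succ G) d) :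
    ¬ L ∣ G := by
  rintro ⟨Q, rfl⟩
  obtain ⟨w, hw, hLw⟩ := exists_ne_zero_eval_eq_zero
    (irreducible_of_isHomogeneous_one hL hL0).not_isUnit
  obtain ⟨x, hx⟩ := IsAlgClosed.exists_pow_nat_eq (-eval w Q) (Nat.pos_of_ne_zero hn)
  have hcons : ∀ q : MvPolynomial (Fin (r + 2)) K,
      eval (Fin.cons x w : Fin (r + 3) → K) (rename Fin.succ q) = eval w q := fun q => by
    rw [eval_rename]; rfl
  have hv : (Fin.cons x w : Fin (r + 3) → K) ≠ 0 := fun h => hw (by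
    funext i
    exact congrFun h i.succ)
  refine hF.not_eval_eq_zero_of_eq_mul (a := rename Fin.succ L)
    (b := X 0 ^ n + rename Fin.succ Q) (by rw [map_mul]; ring) hv (by rw [hcons, hLw]) ?_
  rw [map_add, hcons, map_pow, eval_X, Fin.cons_zero, hx, neg_add_cancel]

theorem irreducible_of_smooth [IsAlgClosed K] {L G : MvPolynomial (Fin (r + 2)) K} (hn : n ≠ 0)
    (hL : L.IsHomogeneous 1) (hL0 : L ≠ 0) {d : ℕ}
    (hF : IsSmoothHypersurface (X 0 ^ n * rename Fin.succ L + rename Fin.succ G) d) :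
    Irreducible (X 0 ^ n * rename Fin.succ L + rename Fin.succ G) := by
  rw [← MulEquiv.irreducible_iff (finSuccEquiv K (r + 2))]
  rw [map_add, map_mul, map_pow, finSuccEquiv_X_zero, finSuccEquiv_rename_succ,
      finSuccEquiv_rename_succ, mul_comm]
  exact irreducible_C_mul_X_pow_add_C (irreducible_of_isHomogeneous_one hL hL0).prime
    (not_dvd_of_smooth hn hL hL0 hF) hn

/-- Modulo F, X₀ⁿ L is -G. A monomial with X₀-exponent nt has t ≤ e, so the factor Lᵉ is enough to
eliminate X₀. The same degree 2e results for every monomial, so ratios of forms of degree e stay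
ratios of forms of equal degree. -/
theorem exists_C_mul_pow_sub_mem {L G : MvPolynomial (Fin r) K} (hL : L.IsHomogeneous 1)
    (hG : G.IsHomogeneous (n + 1)) {e : ℕ} {a : MvPolynomial (Fin (r + 1)) K}
    (ha : a.IsHomogeneous e) (hn : n ≠ 0) (hs : ∀ s, coeff s a ≠ 0 → n ∣ s 0) :
    ∃ q : MvPolynomial (Fin r) K, q.IsHomogeneous (e + e) ∧
      rename Fin.succ L ^ e * a - rename Fin.succ q ∈
        Ideal.span {X 0 ^ n * rename Fin.succ L + rename Fin.succ G} := by
  set F := X 0 ^ n * rename Fin.succ L + rename Fin.succ G with hFdef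
  have hmon : ∀ s ∈ a.support, ∃ q : MvPolynomial (Fin r) K, q.IsHomogeneous (e + e) ∧
      rename Fin.succ L ^ e * monomial s (coeff s a) - rename Fin.succ q ∈ Ideal.span {F} := by
    intro s hsa
    rw [mem_support_iff] at hsa
    obtain ⟨t, ht⟩ := hs s hsa
    have hsum := sum_eq_of_isHomogeneous ha hsa
    rw [Fin.sum_univ_succ, ht] at hsum
    have hte : t ≤ e := by
      have : t ≤ n * t := Nat.le_mul_of_pos_left t (Nat.pos_of_ne_zero hn)
      omega
    obtain ⟨u, rfl⟩ := Nat.exists_eq_add_of_le hte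
    refine ⟨C (coeff s a) * ((-G) ^ t * L ^ u * ∏ i, X i ^ s i.succ), ?_, ?_⟩
    · have h1 : (∏ i, (X i : MvPolynomial (Fin r) K) ^ s i.succ).IsHomogeneous
          (∑ i : Fin r, s i.succ) :=
        IsHomogeneous.prod _ _ _ fun i _ => isHomogeneous_X_pow i _
      have h2 := (((hG.neg.pow t).mul (hL.pow u)).mul h1).C_mul (coeff s a)
      have h3 : (n + 1) * t + 1 * u + ∑ i : Fin r, s i.succ = t + u + (t + u) := by
        have : (n + 1) * t = n * t + t := by ring
        omega
      rwa [h3] at h2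
    · have hm : monomial s (coeff s a) =
          C (coeff s a) * ((X 0 ^ n) ^ t * ∏ i : Fin r, X i.succ ^ s i.succ) := by
        rw [monomial_eq, Finsupp.prod_fintype _ _ (by simp), Fin.prod_univ_succ, ht, pow_mul]
      have hdvd : F ∣ (X 0 ^ n * rename Fin.succ L) ^ t - (-rename Fin.succ G) ^ t := by
        have := sub_dvd_pow_sub_pow (X 0 ^ n * rename Fin.succ L) (-rename Fin.succ G) t
        rwa [sub_neg_eq_add, ← hFdef] at this
      rw [Ideal.mem_span_singleton, hm]
      simp only [map_mul, map_pow, map_neg, map_prod, rename_X, rename_C]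
      exact (hdvd.mul_right (C (coeff s a) * rename Fin.succ L ^ u *
        ∏ i : Fin r, X i.succ ^ s i.succ)).trans (dvd_of_eq (by ring))
  choose! q hq hqF using hmon
  refine ⟨∑ s ∈ a.support, q s, IsHomogeneous.sum _ _ _ hq, ?_⟩
  conv in (rename Fin.succ L ^ e * a) => rw [as_sum a]
  rw [map_sum, Finset.mul_sum, ← Finset.sum_sub_distrib]
  exact Ideal.sum_mem _ hqF

end MonoidalForm

/-! ### Homologies diag(ω, 1, …, 1) in the coordinates given by T. -/

section Homology

variable {K : Type*} [Field K] {r n : ℕ}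

/-- The diagonal matrix with entries `ω, 1, …, 1`. -/
def homologyMatrix (r : ℕ) (ω : K) : Matrix (Fin (r + 1)) (Fin (r + 1)) K :=
  diagonal (Fin.cons ω fun _ => 1)

theorem homologyMatrix_one : homologyMatrix r (1 : K) = 1 := by
  rw [homologyMatrix, ← diagonal_one]
  congr 1
  funext i
  refine Fin.cases rfl (fun _ => rfl) i

theorem coeff_linSubst_homologyMatrix (ω : K) (p : MvPolynomial (Fin (r + 1)) K)
    (s : Fin (r + 1) →₀ ℕ) :
    coeff s (linSubst (homologyMatrix r ω) p) = ω ^ s 0 * coeff s p := by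
  rw [homologyMatrix, coeff_linSubst_diagonal, Fin.prod_univ_succ]
  simp

theorem linSubst_homologyMatrix_eq_self_iff {ω : K} (hω : IsPrimitiveRoot ω n)
    (p : MvPolynomial (Fin (r + 1)) K) :
    linSubst (homologyMatrix r ω) p = p ↔ ∀ s, coeff s p ≠ 0 → n ∣ s 0 := by
  rw [MvPolynomial.ext_iff]
  refine forall_congr' fun s => ?_
  rw [coeff_linSubst_homologyMatrix, ← hω.pow_eq_one_iff_dvd]
  constructor
  · intro h h0
    exact mul_right_cancel₀ h0 (by rw [h, one_mul])
  · intro h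
    by_cases h0 : coeff s p = 0
    · rw [h0, mul_zero]
    · rw [h h0, one_mul]

/-- Conjugation: in the coordinates given by T, substitution by B becomes substitution by D. -/
theorem linSubst_linSubst_of_mul_eq {m : ℕ} {B T D : Matrix (Fin m) (Fin m) K}
    (hB : B * T = T * D) (a : MvPolynomial (Fin m) K) :
    linSubst T (linSubst B a) = linSubst D (linSubst T a) := by
  rw [← linSubst_mul, hB, linSubst_mul]

theorem linSubst_injective {m : ℕ} (T : GL (Fin m) K) :
    Function.Injective (linSubst T.1) :=
  (linSubstEquiv T).injective

theorem notMem_span_of_isHomogeneous {m d e : ℕ} {F a : MvPolynomial (Fin m) K}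
    (hF : F.IsHomogeneous d) (hF0 : F ≠ 0) (ha : a.IsHomogeneous e) (ha0 : a ≠ 0) (hed : e < d) :
    a ∉ Ideal.span {F} := by
  intro h
  obtain ⟨q, rfl⟩ := Ideal.mem_span_singleton.1 h
  have h1 := ha.totalDegree ha0
  rw [totalDegree_mul_of_isDomain hF0 (right_ne_zero_of_mul ha0), hF.totalDegree hF0] at h1
  omega

theorem eval_rep_mk_eq_zero_iff {m : ℕ} {l : MvPolynomial (Fin m) K} {d : ℕ}
    (hl : l.IsHomogeneous d) {v : Fin m → K} (hv : v ≠ 0) :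
    eval (Projectivization.mk K v hv).rep l = 0 ↔ eval v l = 0 :=
  mk_mem_hypersurface hl hv

theorem linSubst_pow_mul_eq {ω : K} {B T : GL (Fin (r + 1)) K}
    (hB : B.1 * T.1 = T.1 * homologyMatrix r ω) (j : ℕ) :
    (B ^ j : GL (Fin (r + 1)) K).1 * T.1 = T.1 * homologyMatrix r (ω ^ j) := by
  induction j with
  | zero =>
    simp [homologyMatrix_one]
  | succ j ih =>
    have : homologyMatrix r (ω ^ (j + 1)) = homologyMatrix r ω * homologyMatrix r (ω ^ j) := by
      rw [homologyMatrix, homologyMatrix, homologyMatrix, diagonal_mul_diagonal]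
      congr 1
      funext i
      refine Fin.cases ?_ (fun _ => ?_) i
      · simp [pow_succ']
      · simp
    rw [pow_succ', Units.val_mul, mul_assoc, ih, ← mul_assoc, hB, this, mul_assoc]

theorem pow_eq_one_of_homology {ω : K} {B T : GL (Fin (r + 1)) K}
    (hB : B.1 * T.1 = T.1 * homologyMatrix r ω) {j : ℕ} (hj : ω ^ j = 1) : B ^ j = 1 := by
  have h := linSubst_pow_mul_eq hB j
  have h0 := linSubst_pow_mul_eq hB 0
  rw [hj, ← pow_zero ω, ← h0, pow_zero] at h
  rw [← Units.val_mul, ← Units.val_mul] at h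
  exact mul_right_cancel (Units.ext h)

/-- The point `T e₀`. -/
noncomputable def homologyCenter (T : GL (Fin (r + 1)) K) : ℙ K (Fin (r + 1) → K) :=
  Projectivization.mk K (T.1 *ᵥ Pi.single 0 1) (mulVec_ne_zero T (by simp))

theorem eval_homologyCenter_eq_zero_iff (T : GL (Fin (r + 1)) K) {d : ℕ}
    {l : MvPolynomial (Fin (r + 1)) K} (hl : l.IsHomogeneous d) :
    eval (homologyCenter T).rep l = 0 ↔ coeff (Finsupp.single 0 d) (linSubst T.1 l) = 0 := by
  rw [homologyCenter, eval_rep_mk_eq_zero_iff hl, ← eval_linSubst,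
    eval_single_one (isHomogeneous_linSubst _ hl)]

/-- In T-coordinates, a linear form vanishing at the centre does not involve X₀, the only coordinate
that the homology scales. -/
theorem linSubst_eq_self_of_mem_coneAlgebra {ω : K} {B T : GL (Fin (r + 1)) K}
    (hB : B.1 * T.1 = T.1 * homologyMatrix r ω) {a : MvPolynomial (Fin (r + 1)) K}
    (ha : a ∈ coneAlgebra (homologyCenter T)) : linSubst B.1 a = a := by
  suffices coneAlgebra (homologyCenter T) ≤
      AlgHom.equalizer (linSubst B.1) (AlgHom.id K _) from this ha
  refine Algebra.adjoin_le ?_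
  rintro l ⟨hl, hl0⟩
  rw [eval_homologyCenter_eq_zero_iff T hl] at hl0
  apply linSubst_injective T
  rw [AlgHom.id_apply, linSubst_linSubst_of_mul_eq hB]
  ext s
  rw [coeff_linSubst_homologyMatrix]
  by_cases hs : coeff s (linSubst T.1 l) = 0
  · rw [hs, mul_zero]
  · have hsum := sum_eq_of_isHomogeneous (isHomogeneous_linSubst T.1 hl) hs
    rw [Fin.sum_univ_succ] at hsum
    have h0 : s 0 = 0 := by
      by_contra h0
      apply hs
      rw [← hl0]
      congr 1
      have hz : ∑ i : Fin r, s i.succ = 0 := by omega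
      rw [Finset.sum_eq_zero_iff] at hz
      ext i
      refine Fin.cases ?_ (fun i => ?_) i
      · simp; omega
      · simpa using hz i
    rw [h0, pow_zero, one_mul]

theorem linSubst_rename_succ_mem_coneAlgebra (T : GL (Fin (r + 1)) K)
    (q : MvPolynomial (Fin r) K) :
    linSubst (T⁻¹ : GL (Fin (r + 1)) K).1 (rename Fin.succ q) ∈
      coneAlgebra (homologyCenter T) := by
  induction q using MvPolynomial.induction_on with
  | C c =>
    rw [rename_C]
    have : linSubst (T⁻¹ : GL (Fin (r + 1)) K).1 (C c) = algebraMap K _ c := by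
      simp [linSubst]
    rw [this]
    exact Subalgebra.algebraMap_mem _ _
  | add p q hp hq => rw [map_add, map_add]; exact Subalgebra.add_mem _ hp hq
  | mul_X p i hp =>
    rw [map_mul, map_mul, rename_X]
    refine Subalgebra.mul_mem _ hp (Algebra.subset_adjoin ?_)
    have hl := isHomogeneous_linSubst (T⁻¹ : GL (Fin (r + 1)) K).1 (isHomogeneous_X K i.succ)
    refine ⟨hl, ?_⟩
    rw [eval_homologyCenter_eq_zero_iff T hl, linSubst_inv_left, coeff_X]
    simp [Finsupp.single_left_inj]

theorem linSubst_mem_span_linSubst_iff {m : ℕ} (T : GL (Fin m) K) {F a : MvPolynomial (Fin m) K} :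
    linSubst T.1 a ∈ Ideal.span {linSubst T.1 F} ↔ a ∈ Ideal.span {F} := by
  rw [Ideal.mem_span_singleton, Ideal.mem_span_singleton]
  exact map_dvd_iff (linSubstEquiv T)

end Homology

/-! ### The fixed field of a homology. -/

section GaloisHomology

variable {K : Type*} [Field K] {r n : ℕ} {F : MvPolynomial (Fin (r + 3)) K}
  {T B : GL (Fin (r + 3)) K} {ω : K}

theorem linSubst_pow_eq_self {m : ℕ} {B : GL (Fin m) K} {a : MvPolynomial (Fin m) K}
    (h : linSubst B.1 a = a) (j : ℕ) : linSubst (B ^ j : GL (Fin m) K).1 a = a := by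
  induction j with
  | zero => simp [linSubst_one]
  | succ j ih => rw [pow_succ, Units.val_mul, linSubst_mul, ih, h]

theorem linSubst_pow_succ {m : ℕ} (B : GL (Fin m) K) (a : MvPolynomial (Fin m) K) (j : ℕ) :
    linSubst B.1 (linSubst (B ^ j : GL (Fin m) K).1 a) =
      linSubst (B ^ (j + 1) : GL (Fin m) K).1 a := by
  rw [← linSubst_mul, ← Units.val_mul, ← pow_succ]

theorem exists_pow_eq_of_mem_zpowers {G : Type*} [Group G] {g h : G} (hg : IsOfFinOrder g)
    (h' : h ∈ Subgroup.zpowers g) : ∃ j : ℕ, g ^ j = h :=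
  hg.mem_powers_iff_mem_zpowers.2 h'

theorem sum_linSubst_pow_eq {m : ℕ} {B : GL (Fin m) K} (hB : B ^ n = 1)
    (a : MvPolynomial (Fin m) K) :
    linSubst B.1 (∑ j ∈ Finset.range n, linSubst (B ^ j : GL (Fin m) K).1 a) =
      ∑ j ∈ Finset.range n, linSubst (B ^ j : GL (Fin m) K).1 a := by
  rw [map_sum]
  simp only [linSubst_pow_succ]
  have h := Finset.sum_range_succ (fun j => linSubst (B ^ j : GL (Fin m) K).1 a) n
  rw [Finset.sum_range_succ', hB, pow_zero] at h
  exact add_right_cancel h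

/-- The product b * c is the norm of b: c collects the translates of b by B, …, Bᵐ. -/
theorem exists_invariant_multiple {m : ℕ} [(Ideal.span {F}).IsPrime] {e : ℕ}
    {B : GL (Fin (r + 3)) K} (hBn : B ^ (m + 1) = 1)
    (hBF : linSubst B.1 F = F) {b : MvPolynomial (Fin (r + 3)) K} (hb : b.IsHomogeneous e)
    (hbF : b ∉ Ideal.span {F}) :
    ∃ (c : MvPolynomial (Fin (r + 3)) K) (e' : ℕ), c.IsHomogeneous e' ∧
      c ∉ Ideal.span {F} ∧ linSubst B.1 (b * c) = b * c := by
  have hmem : ∀ j : ℕ, linSubst (B ^ j : GL (Fin (r + 3)) K).1 b ∉ Ideal.span {F} := fun j => by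
    rwa [linSubst_mem_span_iff one_ne_zero (A := B ^ j)]
    rw [linSubst_pow_eq_self hBF, C_1, one_mul]
  refine ⟨∏ j ∈ Finset.range m, linSubst (B ^ (j + 1) : GL (Fin (r + 3)) K).1 b,
    ∑ j ∈ Finset.range m, e, IsHomogeneous.prod _ _ _ fun j _ => isHomogeneous_linSubst _ hb,
    fun h => ?_, ?_⟩
  · rw [Ideal.IsPrime.prod_mem_iff] at h
    obtain ⟨j, -, hj⟩ := h
    exact hmem _ hj
  · rw [map_mul, map_prod]
    simp only [linSubst_pow_succ]
    have h1 := Finset.prod_range_succ' (fun j => linSubst (B ^ (j + 1) : GL (Fin (r + 3)) K).1 b) m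
    rw [Finset.prod_range_succ, hBn, zero_add, pow_one, Units.val_one, linSubst_one] at h1
    rw [mul_comm b, h1, mul_comm]

variable [(Ideal.span {F}).IsPrime]

/-- In T-coordinates an invariant form has only X₀-exponents divisible by n. After multiplication by
L'ᵉ it is therefore congruent modulo F to a form free of X₀, and L'ᵉ cancels in the ratio. -/
theorem exists_coneAlgebra_ratio (hn : n ≠ 0) (hω : IsPrimitiveRoot ω n)
    (hB : B.1 * T.1 = T.1 * homologyMatrix (r + 2) ω)
    {L G : MvPolynomial (Fin (r + 2)) K} (hL : L.IsHomogeneous 1)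
    (hL0 : linSubst (T⁻¹ : GL (Fin (r + 3)) K).1 (rename Fin.succ L) ∉ Ideal.span {F})
    (hG : G.IsHomogeneous (n + 1))
    (hF : linSubst T.1 F = X 0 ^ n * rename Fin.succ L + rename Fin.succ G)
    {e : ℕ} {a b : MvPolynomial (Fin (r + 3)) K} (ha : a.IsHomogeneous e)
    (hb : b.IsHomogeneous e) (hBa : linSubst B.1 a = a) (hBb : linSubst B.1 b = b)
    (hbF : b ∉ Ideal.span {F}) :
    cls F a / cls F b ∈ ratioField F (coneAlgebra (homologyCenter T)) := by
  set L' := linSubst (T⁻¹ : GL (Fin (r + 3)) K).1 (rename Fin.succ L) with hL'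
  have key : ∀ a : MvPolynomial (Fin (r + 3)) K, a.IsHomogeneous e → linSubst B.1 a = a →
      ∃ q ∈ coneAlgebra (homologyCenter T), q.IsHomogeneous (e + e) ∧
        L' ^ e * a - q ∈ Ideal.span {F} := by
    intro a ha hBa
    have hinv : linSubst (homologyMatrix (r + 2) ω) (linSubst T.1 a) = linSubst T.1 a := by
      rw [← linSubst_linSubst_of_mul_eq hB, hBa]
    obtain ⟨q, hq, hqF⟩ := exists_C_mul_pow_sub_mem hL hG (isHomogeneous_linSubst T.1 ha) hn
      ((linSubst_homologyMatrix_eq_self_iff hω _).1 hinv)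
    refine ⟨_, linSubst_rename_succ_mem_coneAlgebra T q,
      isHomogeneous_linSubst _ hq.rename_isHomogeneous, ?_⟩
    rw [← linSubst_mem_span_linSubst_iff T, map_sub, map_mul, map_pow, hL',
      linSubst_inv_left, linSubst_inv_left, hF]
    exact hqF
  obtain ⟨p, hpR, hp, hpF⟩ := key a ha hBa
  obtain ⟨q, hqR, hq, hqF⟩ := key b hb hBb
  have hLe : L' ^ e ∉ Ideal.span {F} := fun h => hL0 (Ideal.IsPrime.mem_of_pow_mem ‹_› _ h)
  have hcp := cls_eq_cls_iff.2 hpF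
  have hcq := cls_eq_cls_iff.2 hqF
  have hq0 : q ∉ Ideal.span {F} := by
    rw [← cls_eq_zero_iff, ← hcq, cls_eq_zero_iff]
    exact fun h => (Ideal.IsPrime.mem_or_mem ‹_› h).elim hLe hbF
  refine ⟨e + e, p, q, hpR, hqR, hp, hq, hq0, ?_⟩
  rw [← hcp, ← hcq, map_mul, map_mul, mul_div_mul_left _ _ (cls_ne_zero hLe)]

/-- The elements of the function field that are fixed by the pullback along `B` are ratios of
`B`-invariant forms. -/
theorem exists_invariant_ratio [CharZero K] (hn : n ≠ 0) (hBn : B ^ n = 1) (hBF : linSubst B.1 F = F)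
    {φ : ℕ → functionField F → functionField F}
    (hφ : ∀ j, IsPullback F (B ^ j) (φ j)) {x : functionField F} (hx : ∀ j, φ j x = x) :
    ∃ (e : ℕ) (a b : MvPolynomial (Fin (r + 3)) K), a.IsHomogeneous e ∧ b.IsHomogeneous e ∧
      linSubst B.1 a = a ∧ linSubst B.1 b = b ∧ b ∉ Ideal.span {F} ∧
      x.1 = cls F a / cls F b := by
  obtain ⟨e, a, b, -, -, ha, hb, hbF, hxab⟩ := x.2
  obtain ⟨m, rfl⟩ := Nat.exists_eq_succ_of_ne_zero hn
  obtain ⟨c, e', hc, hcF, hinv⟩ := exists_invariant_multiple hBn hBF hb hbF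
  have hbc : b * c ∉ Ideal.span {F} := fun h => (Ideal.IsPrime.mem_or_mem ‹_› h).elim hbF hcF
  have hx1 : x.1 = cls F (a * c) / cls F (b * c) := by
    rw [hxab, map_mul, map_mul, mul_div_mul_right _ _ (cls_ne_zero hcF)]
  -- With an invariant denominator, invariance of x makes the numerator invariant modulo F only.
  -- Summing over all powers of B gives an honestly invariant form whose class is m + 1 times the
  -- old one.
  have hcls : ∀ j, cls F (linSubst (B ^ j : GL (Fin (r + 3)) K).1 (a * c)) = cls F (a * c) := by
    intro j
    have h := (hφ j _ _ _ x (ha.mul hc) (hb.mul hc) hbc hx1).2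
    change _ = cls F (linSubst _ _) / cls F (linSubst _ _) at h
    rw [hx j, hx1, linSubst_pow_eq_self hinv] at h
    exact ((div_left_inj' (cls_ne_zero hbc)).1 h).symm
  have hC : linSubst B.1 (C ((m + 1 : ℕ) : K)) = C ((m + 1 : ℕ) : K) := by simp [linSubst]
  have hm : ((m + 1 : ℕ) : K) ≠ 0 := Nat.cast_ne_zero.2 (Nat.succ_ne_zero m)
  have hCF : (C ((m + 1 : ℕ) : K) : MvPolynomial (Fin (r + 3)) K) ∉ Ideal.span {F} := fun h =>
    Ideal.IsPrime.ne_top ‹_› (Ideal.eq_top_of_isUnit_mem _ h ((IsUnit.mk0 _ hm).map C))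
  refine ⟨e + e', ∑ j ∈ Finset.range (m + 1),
    linSubst (B ^ j : GL (Fin (r + 3)) K).1 (a * c), C ((m + 1 : ℕ) : K) * (b * c),
    IsHomogeneous.sum _ _ _ fun j _ => isHomogeneous_linSubst _ (ha.mul hc),
    (hb.mul hc).C_mul _, sum_linSubst_pow_eq hBn _, by rw [map_mul, hC, hinv],
    fun h => (Ideal.IsPrime.mem_or_mem ‹_› h).elim hCF hbc, ?_⟩
  rw [map_sum, Finset.sum_congr rfl fun j _ => hcls j, Finset.sum_const, Finset.card_range,
    nsmul_eq_mul, map_mul (cls F) (C _), hx1]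
  have : cls F (C ((m + 1 : ℕ) : K)) = ((m + 1 : ℕ) :
      FractionRing (MvPolynomial (Fin (r + 3)) K ⧸ Ideal.span {F})) := by
    rw [map_natCast, map_natCast]
  rw [← this, mul_div_mul_left _ _ (cls_ne_zero hCF)]

end GaloisHomology

/-- If a homology of order `n` with centre on the smooth hypersurface `F = 0` of degree `n + 1`
preserves the hypersurface, then its centre is a Galois point. -/
theorem exists_isGaloisPoint_of_homology {K : Type*} [Field K] [IsAlgClosed K] [CharZero K]
    {r n : ℕ} {F : MvPolynomial (Fin (r + 3)) K} {T B : GL (Fin (r + 3)) K} {ω : K} (hn : n ≠ 0)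
    (hF : IsSmoothHypersurface F (n + 1)) (hω : IsPrimitiveRoot ω n)
    (hs : ∀ s, coeff s (linSubst T.1 F) ≠ 0 → s 0 = 0 ∨ s 0 = n)
    (hB : B.1 * T.1 = T.1 * homologyMatrix (r + 2) ω) :
    ∃ P ∈ hypersurface F, IsGaloisPoint F P ∧
      IsGaloisGroupOfProjection F P (Subgroup.zpowers (ProjGenLinGroup.mk B)) := by
  obtain ⟨L, G, hL, hL0, hG, hFT⟩ := exists_eq_X_pow_mul_add hn (hF.linSubst T) hs
  have hirr : Irreducible F := by
    rw [← MulEquiv.irreducible_iff (linSubstEquiv T), linSubstEquiv_apply, hFT]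
    exact irreducible_of_smooth hn hL hL0 (hFT ▸ hF.linSubst T)
  have : (Ideal.span {F}).IsPrime :=
    (Ideal.span_singleton_prime hirr.ne_zero).2 hirr.prime
  have hBn : B ^ n = 1 := pow_eq_one_of_homology hB hω.pow_eq_one
  have hBF : linSubst B.1 F = F := by
    apply linSubst_injective T
    rw [linSubst_linSubst_of_mul_eq hB, linSubst_homologyMatrix_eq_self_iff hω]
    intro s h
    rcases hs s h with h | h <;> simp [h]
  have hfin : IsOfFinOrder (ProjGenLinGroup.mk B) :=
    isOfFinOrder_iff_pow_eq_one.2 ⟨n, Nat.pos_of_ne_zero hn, by rw [← map_pow, hBn, map_one]⟩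
  have : Finite (Subgroup.zpowers (ProjGenLinGroup.mk B)) := by
    exact (finite_zpowers.2 hfin).to_subtype
  have hpow : ∀ h : Subgroup.zpowers (ProjGenLinGroup.mk B),
      ∃ j : ℕ, ProjGenLinGroup.mk (B ^ j) = (h : PGL(Fin (r + 3), K))⁻¹ := by
    intro h
    obtain ⟨j, hj⟩ := exists_pow_eq_of_mem_zpowers hfin (inv_mem h.2)
    exact ⟨j, by rw [map_pow, hj]⟩
  obtain ⟨ρ, hρ⟩ := exists_pullback_monoidHom (F := F)
    (Subgroup.zpowers (ProjGenLinGroup.mk B)) (by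
      intro h hh
      obtain ⟨j, hj⟩ := exists_pow_eq_of_mem_zpowers hfin hh
      exact ⟨B ^ j, 1, by rw [map_pow, hj], one_ne_zero,
        by rw [linSubst_pow_eq_self hBF, C_1, one_mul]⟩)
  -- F has degree n + 1 ≥ 2, so it divides no nonzero linear form.
  have hlin : ∀ a : MvPolynomial (Fin (r + 3)) K, a.IsHomogeneous 1 → a ≠ 0 →
      linSubst (T⁻¹ : GL (Fin (r + 3)) K).1 a ∉ Ideal.span {F} := fun a ha ha0 =>
    notMem_span_of_isHomogeneous hF.1 hF.ne_zero (isHomogeneous_linSubst _ ha)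
      ((map_ne_zero_iff _ (linSubst_injective T⁻¹)).2 ha0) (by omega)
  refine ⟨homologyCenter T, ?_, isGaloisGroupOfProjection_of_fixed hρ ?_ ?_ ?_⟩
  · change eval _ F = 0
    rw [eval_homologyCenter_eq_zero_iff T hF.1]
    by_contra h
    have := hs _ h
    simp at this
  · intro h hh
    obtain ⟨j, hj⟩ := hpow h
    -- Faithfulness is tested on X₀/X₁ in T-coordinates, which Bʲ multiplies by ωʲ.
    let y := linSubst (T⁻¹ : GL (Fin (r + 3)) K).1 (X 0)
    let z := linSubst (T⁻¹ : GL (Fin (r + 3)) K).1 (X 1)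
    have hy : y ∉ Ideal.span {F} := hlin _ (isHomogeneous_X _ _) (X_ne_zero _)
    have hz : z ∉ Ideal.span {F} := hlin _ (isHomogeneous_X _ _) (X_ne_zero _)
    have hy1 := isHomogeneous_linSubst (T⁻¹ : GL (Fin (r + 3)) K).1 (isHomogeneous_X K 0)
    have hz1 := isHomogeneous_linSubst (T⁻¹ : GL (Fin (r + 3)) K).1 (isHomogeneous_X K 1)
    let x : functionField F := ⟨cls F y / cls F z,
      1, y, z, Algebra.mem_top, Algebra.mem_top, hy1, hz1, hz, rfl⟩
    have hpb := (hρ h (B ^ j) hj 1 y z x hy1 hz1 hz rfl).2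
    change _ = cls F (linSubst _ _) / cls F (linSubst _ _) at hpb
    have hconj := linSubst_pow_mul_eq hB j
    have hBy : linSubst (B ^ j : GL (Fin (r + 3)) K).1 y = C (ω ^ j) * y := by
      apply linSubst_injective T
      rw [linSubst_linSubst_of_mul_eq hconj, map_mul, linSubst_inv_left]
      have : linSubst T.1 (C (ω ^ j)) = C (ω ^ j) := by simp [linSubst]
      rw [this]
      ext s
      rw [coeff_linSubst_homologyMatrix, coeff_C_mul, coeff_X]
      split_ifs with h
      · rw [← h]; simp
      · simp
    have hBz : linSubst (B ^ j : GL (Fin (r + 3)) K).1 z = z := by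
      apply linSubst_injective T
      rw [linSubst_linSubst_of_mul_eq hconj, linSubst_inv_left]
      ext s
      rw [coeff_linSubst_homologyMatrix, coeff_X]
      split_ifs with h
      · rw [← h]; simp
      · simp
    rw [hh x, hBy, hBz] at hpb
    have h1 := (div_left_inj' (cls_ne_zero hz)).1 hpb
    rw [cls_eq_cls_iff, show y - C (ω ^ j) * y = C (1 - ω ^ j) * y by
      rw [C_sub, C_1]; ring] at h1
    have hωj : ω ^ j = 1 := by
      by_contra hne
      refine (Ideal.IsPrime.mem_or_mem ‹_› h1).elim (fun h => ?_) hy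
      exact Ideal.IsPrime.ne_top ‹_› (Ideal.eq_top_of_isUnit_mem _ h
        ((IsUnit.mk0 _ (sub_ne_zero.2 (Ne.symm hne))).map C))
    rw [pow_eq_one_of_homology hB hωj, map_one] at hj
    exact Subtype.ext (inv_eq_one.1 hj.symm)
  · rintro h x ⟨e, a, b, haR, hbR, ha, hb, hbF, hx⟩
    obtain ⟨j, hj⟩ := hpow h
    have hpb := (hρ h (B ^ j) hj e a b x ha hb hbF hx).2
    change _ = cls F (linSubst _ _) / cls F (linSubst _ _) at hpb
    rw [linSubst_pow_eq_self (linSubst_eq_self_of_mem_coneAlgebra hB haR),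
      linSubst_pow_eq_self (linSubst_eq_self_of_mem_coneAlgebra hB hbR)] at hpb
    exact Subtype.ext (hpb.trans hx.symm)
  · intro x hx
    let h : ℕ → Subgroup.zpowers (ProjGenLinGroup.mk B) := fun j =>
      ⟨(ProjGenLinGroup.mk B ^ j)⁻¹, inv_mem (Subgroup.npow_mem_zpowers _ _)⟩
    obtain ⟨e, a, b, ha, hb, hBa, hBb, hbF, hxab⟩ :=
      exists_invariant_ratio hn hBn hBF (φ := fun j => ρ (h j))
        (fun j => hρ (h j) (B ^ j) (by simp [h])) (x := x) fun j => hx (h j)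
    change x.1 ∈ ratioField F _
    rw [hxab]
    exact exists_coneAlgebra_ratio hn hω hB hL
      (hlin _ hL.rename_isHomogeneous
        ((map_ne_zero_iff _ (rename_injective _ (Fin.succ_injective _))).2 hL0))
      hG hFT ha hb hBa hBb hbF

/-! ### Lines and finite sets in the Zariski topology. -/

section Zariski

variable {K : Type*} [Field K] {m : ℕ}

theorem submodule_le_iff_rep_mem {p : ℙ K (Fin m → K)} {W : Submodule K (Fin m → K)} :
    p.submodule ≤ W ↔ p.rep ∈ W := by
  rw [Projectivization.submodule_eq, Submodule.span_singleton_le_iff_mem]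

theorem finite_setOf_rep_mem_span_singleton (v : Fin m → K) :
    {p : ℙ K (Fin m → K) | p.rep ∈ Submodule.span K {v}}.Finite := by
  refine Set.Subsingleton.finite fun p hp q hq => ?_
  obtain ⟨a, ha⟩ := Submodule.mem_span_singleton.1 hp
  obtain ⟨b, hb⟩ := Submodule.mem_span_singleton.1 hq
  have hb0 : b ≠ 0 := by
    rintro rfl
    exact q.rep_nonzero (by rw [← hb, zero_smul])
  rw [← p.mk_rep, ← q.mk_rep, Projectivization.mk_eq_mk_iff']
  exact ⟨a * b⁻¹, by rw [← ha, ← hb, smul_smul, mul_assoc, inv_mul_cancel₀ hb0, mul_one]⟩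

theorem exists_forall_mem_span_pair {W : Submodule K (Fin m → K)} (hW : Module.finrank K W ≤ 2)
    {w₀ : Fin m → K} (h₀ : w₀ ∈ W) (hne : w₀ ≠ 0) :
    ∃ w₁, ∀ w ∈ W, ∃ a b : K, a • w₀ + b • w₁ = w := by
  by_cases h : ∀ w ∈ W, w ∈ Submodule.span K {w₀}
  · refine ⟨0, fun w hw => ?_⟩
    obtain ⟨a, ha⟩ := Submodule.mem_span_singleton.1 (h w hw)
    exact ⟨a, 0, by simpa using ha⟩
  · push Not at h
    obtain ⟨w₁, h₁, hn⟩ := h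
    have hli : LinearIndependent K ![w₀, w₁] := by
      rw [LinearIndependent.pair_iff' hne]
      intro a ha
      exact hn (Submodule.mem_span_singleton.2 ⟨a, ha⟩)
    have hle : Submodule.span K {w₀, w₁} ≤ W := by
      rw [Submodule.span_le]
      rintro x (rfl | rfl)
      · exact h₀
      · exact h₁
    have hfr : Module.finrank K (Submodule.span K {w₀, w₁}) = 2 := by
      have := finrank_span_eq_card hli
      rwa [show Set.range ![w₀, w₁] = {w₀, w₁} by simp [Set.pair_comm], Fintype.card_fin] at this
    have heq := Submodule.eq_of_le_of_finrank_le hle (by rw [hfr]; exact hW)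
    refine ⟨w₁, fun w hw => ?_⟩
    rw [← heq] at hw
    exact Submodule.mem_span_pair.1 hw

/-- A form that does not vanish identically on a line has finitely many zeros on it. -/
theorem finite_zeros_on_line {W : Submodule K (Fin m → K)} (hW : Module.finrank K W ≤ 2)
    {f : MvPolynomial (Fin m) K} {n : ℕ} (hf : f.IsHomogeneous n) {p₀ : ℙ K (Fin m → K)}
    (hp₀ : p₀.rep ∈ W) (h0 : eval p₀.rep f ≠ 0) :
    {p : ℙ K (Fin m → K) | p.rep ∈ W ∧ eval p.rep f = 0}.Finite := by
  obtain ⟨w, hw⟩ := exists_forall_mem_span_pair hW hp₀ p₀.rep_nonzero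
  -- The restriction of f to the affine chart p₀ + s w of the line. It is nonzero at s = 0, so it
  -- has finitely many roots; the chart misses at most the point w.
  let h : Polynomial K :=
    aeval (fun i => Polynomial.C (p₀.rep i) + Polynomial.X * Polynomial.C (w i)) f
  have heval : ∀ s, h.eval s = eval (p₀.rep + s • w) f := by
    intro s
    have : ((Polynomial.aeval s).comp (aeval fun i =>
        Polynomial.C (p₀.rep i) + Polynomial.X * Polynomial.C (w i)) :
          MvPolynomial (Fin m) K →ₐ[K] K) = aeval (p₀.rep + s • w) := by
      ext i
      simp
      ring
    have h2 := congrArg (fun g => g f) this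
    simpa [h, Polynomial.coe_aeval_eq_eval, aeval_eq_eval] using h2
  have hh : h ≠ 0 := by
    intro h1
    have := heval 0
    rw [h1] at this
    simp at this
    exact h0 this.symm
  have hroots : {s : K | h.eval s = 0}.Finite := by
    exact Polynomial.finite_setOfPred_isRoot hh
  refine ((finite_setOf_rep_mem_span_singleton w).union
    (hroots.biUnion fun s _ => finite_setOf_rep_mem_span_singleton (p₀.rep + s • w))).subset ?_
  rintro p ⟨hpW, hpf⟩
  obtain ⟨a, b, hab⟩ := hw _ hpW
  by_cases ha : a = 0
  · left
    rw [ha, zero_smul, zero_add] at hab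
    exact Submodule.mem_span_singleton.2 ⟨b, hab⟩
  · right
    have hab' : a • (p₀.rep + (b / a) • w) = p.rep := by
      rw [← hab, smul_add, smul_smul, mul_div_cancel₀ _ ha]
    refine Set.mem_biUnion (x := b / a) ?_ (Submodule.mem_span_singleton.2 ⟨a, hab'⟩)
    change h.eval (b / a) = 0
    rw [heval]
    rw [← hab', eval_smul_of_isHomogeneous hf] at hpf
    exact (mul_eq_zero.1 hpf).resolve_left (pow_ne_zero _ ha)

/-- There are finitely many eigenspaces, each projecting to at most a line. Such a line meets the
hypersurface in finitely many points or lies in it, and then it is a line of fixed points. -/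
theorem finite_fixedLocus {F : MvPolynomial (Fin m) K} {d : ℕ} (hF : F.IsHomogeneous d)
    (A : GL (Fin m) K)
    (hA : ∀ c, Module.finrank K (Module.End.eigenspace (toLin' A.1) c) ≤ 2)
    (hline : ¬ ContainsLine (fixedLocus F (ProjGenLinGroup.mk A))) :
    (fixedLocus F (ProjGenLinGroup.mk A)).Finite := by
  have hmem : ∀ {p : ℙ K (Fin m → K)} {c : K}, p.rep ∈ Module.End.eigenspace (toLin' A.1) c ↔
      A.1 *ᵥ p.rep = c • p.rep := by
    intro p c
    rw [Module.End.mem_eigenspace_iff, toLin'_apply]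
  have hfin : {c : K | Module.End.HasEigenvalue (toLin' A.1) c}.Finite :=
    Module.End.finite_hasEigenvalue _
  refine (hfin.biUnion (t := fun c => {p : ℙ K (Fin m → K) |
    p.rep ∈ Module.End.eigenspace (toLin' A.1) c ∧ eval p.rep F = 0}) fun c _ => ?_).subset ?_
  · by_cases h : ∃ p₀ : ℙ K (Fin m → K), p₀.rep ∈ Module.End.eigenspace (toLin' A.1) c ∧
      eval p₀.rep F ≠ 0
    · obtain ⟨p₀, h1, h2⟩ := h
      exact finite_zeros_on_line (hA c) hF h1 h2
    · push Not at h
      by_cases h2 : Module.finrank K (Module.End.eigenspace (toLin' A.1) c) = 2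
      · refine absurd ⟨_, h2, fun p hp => ?_⟩ hline
        rw [submodule_le_iff_rep_mem] at hp
        exact ⟨h p hp, (mk_smul_eq_self_iff A p).2 ⟨c, hmem.1 hp⟩⟩
      · have h1 : Module.finrank K (Module.End.eigenspace (toLin' A.1) c) ≤ 1 := by
          have := hA c
          omega
        obtain ⟨v, hv⟩ := finrank_le_one_iff.1 h1
        refine (finite_setOf_rep_mem_span_singleton v.1).subset fun p hp => ?_
        obtain ⟨a, ha⟩ := hv ⟨p.rep, hp.1⟩
        exact Submodule.mem_span_singleton.2 ⟨a, congrArg Subtype.val ha⟩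
  · rintro p ⟨hpF, hp⟩
    obtain ⟨c, hc⟩ := (mk_smul_eq_self_iff A p).1 hp
    refine Set.mem_biUnion (x := c) ?_ ⟨hmem.2 hc, hpF⟩
    exact Module.End.hasEigenvalue_of_hasEigenvector (x := p.rep) ⟨hmem.2 hc, p.rep_nonzero⟩

theorem t1Space_zariskiTopology : @T1Space (ℙ K (Fin m → K)) (zariskiTopology K m) := by
  let := zariskiTopology K m
  rw [t1Space_iff_exists_open]
  intro p q hpq
  have h : ∃ i j, p.rep i * q.rep j ≠ p.rep j * q.rep i := by
    by_contra! hall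
    apply hpq
    obtain ⟨k, hk⟩ := Function.ne_iff.1 q.rep_nonzero
    rw [← p.mk_rep, ← q.mk_rep, Projectivization.mk_eq_mk_iff']
    refine ⟨p.rep k / q.rep k, ?_⟩
    funext i
    have hk' : q.rep k ≠ 0 := hk
    rw [Pi.smul_apply, smul_eq_mul, div_mul_eq_mul_div, div_eq_iff hk', ← hall i k]
  obtain ⟨i, j, hij⟩ := h
  -- This linear form vanishes at q but, by the choice of i and j, not at p.
  refine ⟨{x | eval x.rep (C (q.rep j) * X i - C (q.rep i) * X j) ≠ 0},
    TopologicalSpace.isOpen_generateFrom_of_mem ⟨1, _,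
      ((isHomogeneous_C_mul_X _ _).sub (isHomogeneous_C_mul_X _ _)), rfl⟩, ?_, ?_⟩
  · change eval p.rep _ ≠ 0
    simp only [map_sub, map_mul, eval_C, eval_X]
    intro h
    apply hij
    linear_combination h
  · change ¬ (eval q.rep _ ≠ 0)
    simp only [map_sub, map_mul, eval_C, eval_X]
    push Not
    ring

theorem zariskiDim_le_zero_of_finite {Z : Set (ℙ K (Fin m → K))} (hZ : Z.Finite) :
    zariskiDim Z ≤ 0 := by
  let := zariskiTopology K m
  have : T1Space (ℙ K (Fin m → K)) := t1Space_zariskiTopology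
  have : Finite Z := hZ
  exact topologicalKrullDim_zero_of_discreteTopology Z

/-- A Zariski open set that meets a line contains all but finitely many of its points. -/
theorem finite_line_diff_open {W : Submodule K (Fin m → K)} (hW : Module.finrank K W ≤ 2)
    {U : Set (ℙ K (Fin m → K))} (hU : @IsOpen _ (zariskiTopology K m) U)
    (hne : ∃ p ∈ U, p.rep ∈ W) : {p : ℙ K (Fin m → K) | p.rep ∈ W ∧ p ∉ U}.Finite := by
  induction hU with
  | basic s hs =>
    obtain ⟨n, f, hf, rfl⟩ := hs
    obtain ⟨p₀, h1, h2⟩ := hne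
    refine (finite_zeros_on_line hW hf h2 h1).subset fun p hp => ⟨hp.1, ?_⟩
    by_contra h
    exact hp.2 h
  | univ => simp
  | inter s t _ _ hs ht =>
    obtain ⟨p, ⟨h1, h2⟩, h3⟩ := hne
    refine ((hs ⟨p, h1, h3⟩).union (ht ⟨p, h2, h3⟩)).subset fun q hq => ?_
    by_cases hqs : q ∈ s
    · exact Or.inr ⟨hq.1, fun hqt => hq.2 ⟨hqs, hqt⟩⟩
    · exact Or.inl ⟨hq.1, hqs⟩
  | sUnion S _ ih =>
    obtain ⟨p, ⟨s, hs, hps⟩, hpW⟩ := hne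
    exact (ih s hs ⟨p, hps, hpW⟩).subset fun q hq => ⟨hq.1, fun hqs => hq.2 ⟨s, hs, hqs⟩⟩

end Zariski

/-! ### Diagonalization of finite-order projective transformations. -/

section Eigenbasis

variable {K : Type*} [Field K] {m : ℕ}

theorem exists_GL_of_basis (b : Module.Basis (Fin m) K (Fin m → K)) :
    ∃ T : GL (Fin m) K, ∀ i, T.1 *ᵥ Pi.single i 1 = b i := by
  refine ⟨⟨(Pi.basisFun K (Fin m)).toMatrix b, b.toMatrix (Pi.basisFun K (Fin m)),
    Module.Basis.toMatrix_mul_toMatrix_flip _ _, Module.Basis.toMatrix_mul_toMatrix_flip _ _⟩,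
    fun i => ?_⟩
  rw [mulVec_single_one]
  ext j
  simp [Module.Basis.toMatrix_apply]

theorem mul_eq_mul_diagonal {A T : Matrix (Fin m) (Fin m) K}
    {b : Fin m → Fin m → K} (hT : ∀ i, T *ᵥ Pi.single i 1 = b i)
    {μ : Fin m → K} (hA : ∀ i, A *ᵥ b i = μ i • b i) : A * T = T * diagonal μ := by
  have hcol : ∀ i j, T j i = b i j := fun i j => by
    rw [← hT i, mulVec_single_one]; rfl
  ext j i
  have h := congrFun (hA i) j
  rw [mul_diagonal, hcol, mul_comm]
  rw [Pi.smul_apply, smul_eq_mul] at h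
  rw [← h, mul_apply, mulVec, dotProduct]
  exact Finset.sum_congr rfl fun k _ => by rw [hcol]

/-- A is a root of Xᴺ - u with u ≠ 0, which is separable in characteristic zero. So A is semisimple
and a basis can be chosen among its eigenvectors. -/
theorem exists_eigenbasis [IsAlgClosed K] [CharZero K] {A : GL (Fin m) K} {N : ℕ} (hN : N ≠ 0)
    (hA : ProjGenLinGroup.mk A ^ N = 1) :
    ∃ (b : Module.Basis (Fin m) K (Fin m → K)) (μ : Fin m → K),
      ∀ i, A.1 *ᵥ b i = μ i • b i := by
  rw [← map_pow, ← map_one ProjGenLinGroup.mk, eq_comm, ProjGenLinGroup.mk_eq_mk_iff] at hA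
  obtain ⟨u, hu⟩ := hA
  rw [one_mul] at hu
  have hpoly : Polynomial.aeval (toLin' A.1) (Polynomial.X ^ N - Polynomial.C (u : K)) = 0 := by
    rw [map_sub, map_pow, Polynomial.aeval_X, Polynomial.aeval_C, ← toLin'_pow,
      ← Units.val_pow_eq_pow_val, ← hu]
    ext i j
    simp [Module.algebraMap_end_apply, Pi.single_apply]
  have hss : Module.End.IsSemisimple (toLin' A.1) :=
    Module.End.isSemisimple_of_squarefree_aeval_eq_zero
      (Polynomial.separable_X_pow_sub_C _ (Nat.cast_ne_zero.2 hN) u.ne_zero).squarefree hpoly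
  have htop := hss.iSup_eigenspace_eq_top
  let s : Set (Fin m → K) := {v | ∃ c : K, A.1 *ᵥ v = c • v}
  have hs : ⊤ ≤ Submodule.span K s := by
    rw [← htop, iSup_le_iff]
    intro c v hv
    refine Submodule.subset_span ⟨c, ?_⟩
    rwa [Module.End.mem_eigenspace_iff, toLin'_apply] at hv
  let b₀ := Module.Basis.ofSpan hs
  have : Fintype ((linearIndepOn_empty K id).extend (Set.empty_subset s)) :=
    FiniteDimensional.fintypeBasisIndex b₀
  have hcard : Fintype.card ((linearIndepOn_empty K id).extend (Set.empty_subset s)) =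
      Fintype.card (Fin m) := by
    rw [← Module.finrank_eq_card_basis b₀]
    simp
  let b := b₀.reindex (Fintype.equivOfCardEq hcard)
  have hb : ∀ i, ∃ c : K, A.1 *ᵥ b i = c • b i := fun i =>
    Module.Basis.ofSpan_subset hs ⟨(Fintype.equivOfCardEq hcard).symm i, by simp [b, b₀]⟩
  choose μ hμ using hb
  exact ⟨b, μ, hμ⟩

theorem finrank_eigenspace_le_card {A : Matrix (Fin m) (Fin m) K}
    (b : Module.Basis (Fin m) K (Fin m → K)) {μ : Fin m → K}
    (hA : ∀ i, A *ᵥ b i = μ i • b i) (c : K) [DecidableEq K] :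
    Module.finrank K (Module.End.eigenspace (toLin' A) c) ≤
      (Finset.univ.filter fun i => μ i = c).card := by
  classical
  let S := (Finset.univ.filter fun i => μ i = c).image b
  have hle : Module.End.eigenspace (toLin' A) c ≤ Submodule.span K (S : Set (Fin m → K)) := by
    intro v hv
    rw [Module.End.mem_eigenspace_iff, toLin'_apply] at hv
    have h1 : ∀ i, b.repr v i ≠ 0 → μ i = c := by
      intro i hi
      have h2 : A *ᵥ v = ∑ j, (b.repr v j * μ j) • b j := by
        conv_lhs => rw [← b.sum_repr v]
        rw [mulVec_sum]
        refine Finset.sum_congr rfl fun j _ => ?_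
        rw [mulVec_smul, hA, smul_smul]
      have h3 := congrArg (fun w => b.repr w i) (h2.symm.trans hv)
      simp only [b.repr_sum_self, map_smul, Finsupp.smul_apply, smul_eq_mul] at h3
      rw [mul_comm] at h3
      exact mul_right_cancel₀ hi h3
    rw [← b.sum_repr v]
    refine Submodule.sum_mem _ fun i _ => ?_
    by_cases hi : b.repr v i = 0
    · rw [hi, zero_smul]; exact Submodule.zero_mem _
    · refine Submodule.smul_mem _ _ (Submodule.subset_span ?_)
      exact Finset.mem_coe.2 (Finset.mem_image_of_mem _ (by simp [h1 i hi]))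
  calc _ ≤ Module.finrank K (Submodule.span K (S : Set (Fin m → K))) :=
        Submodule.finrank_mono hle
    _ ≤ S.card := finrank_span_finset_le_card S
    _ ≤ _ := Finset.card_image_le

theorem exists_perm_of_three_le_card {S : Finset (Fin 5)} (hS : 3 ≤ S.card) :
    ∃ σ : Equiv.Perm (Fin 5), σ 2 ∈ S ∧ σ 3 ∈ S ∧ σ 4 ∈ S := by
  obtain ⟨S', hS', hcard⟩ := Finset.exists_subset_card_eq hS
  have e : {i // i ∈ ({2, 3, 4} : Finset (Fin 5))} ≃ {i // i ∈ S'} :=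
    Fintype.equivOfCardEq (by rw [Fintype.card_coe, Fintype.card_coe, hcard]; rfl)
  exact ⟨e.extendSubtype, hS' (e.extendSubtype_mem 2 (by decide)),
    hS' (e.extendSubtype_mem 3 (by decide)), hS' (e.extendSubtype_mem 4 (by decide))⟩

end Eigenbasis

/-! ### Arithmetic of the eigenvalues and proof of part (1). -/

/-- A relation xⁿ y = 1 raised to the power k gives yᵏ = 1, because the kn-th power of x is 1. The
only case without such a relation is αⁿ = βⁿ = 1, and then kn would divide n. -/
theorem pow_eq_one_or_pow_eq_one_of_orders {M : Type*} [CommMonoid M] {α β : M} {n k : ℕ}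
    (hn : 2 ≤ n) (hk : 2 ≤ k) (hα : α ^ (k * n) = 1) (hβ : β ^ (k * n) = 1)
    (hord : ∀ e, α ^ e = 1 → β ^ e = 1 → k * n ∣ e)
    (h₁ : β ^ n = 1 ∨ β ^ n * β = 1 ∨ β ^ n * α = 1)
    (h₂ : α ^ n = 1 ∨ α ^ n * α = 1 ∨ α ^ n * β = 1) : α ^ k = 1 ∨ β ^ k = 1 := by
  have hkn : 2 * n ≤ k * n := Nat.mul_le_mul_right n hk
  have aux : ∀ x y : M, x ^ (k * n) = 1 → x ^ n * y = 1 → y ^ k = 1 := by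
    intro x y hx hxy
    have h := congrArg (· ^ k) hxy
    simp only [mul_pow, one_pow, ← pow_mul, mul_comm n k, hx, one_mul] at h
    exact h
  rcases h₁ with h₁ | h₁ | h₁
  · rcases h₂ with h₂ | h₂ | h₂
    · have := Nat.le_of_dvd (by omega) (hord n h₂ h₁)
      omega
    · exact Or.inl (aux α α hα h₂)
    · exact Or.inr (aux α β hα h₂)
  · exact Or.inr (aux β β hβ h₁)
  · exact Or.inl (aux β α hβ h₁)

theorem isPrimitiveRoot_pow_of_orders {M : Type*} [CommMonoid M] {α β : M} {n k : ℕ}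
    (hk : k ≠ 0) (hβ : β ^ (k * n) = 1) (hord : ∀ e, α ^ e = 1 → β ^ e = 1 → k * n ∣ e)
    (hα : α ^ k = 1) : IsPrimitiveRoot (β ^ k) n := by
  refine ⟨by rw [← pow_mul, hβ], fun e he => ?_⟩
  rw [← pow_mul] at he
  exact Nat.dvd_of_mul_dvd_mul_left (Nat.pos_of_ne_zero hk)
    (hord (k * e) (by rw [pow_mul, hα, one_pow]) he)

section PositiveResult

variable {K : Type*} [Field K]

theorem pow_mulVec_eq {m : ℕ} {A : GL (Fin m) K} {v : Fin m → K} {c : K}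
    (h : A.1 *ᵥ v = c • v) (e : ℕ) : (A ^ e : GL (Fin m) K).1 *ᵥ v = c ^ e • v := by
  induction e with
  | zero => simp
  | succ e ih => rw [pow_succ, Units.val_mul, ← mulVec_mulVec, h, mulVec_smul, ih, smul_smul,
      pow_succ']

theorem scalar_mulVec {m : ℕ} (u : Kˣ) (v : Fin m → K) :
    (GeneralLinearGroup.scalar (Fin m) u).1 *ᵥ v = (u : K) • v := by
  ext j
  simp [mulVec_diagonal, scalar_apply]

theorem le_of_coeff_ne_zero {m d : ℕ} {F : MvPolynomial (Fin m) K} (hF : F.IsHomogeneous d)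
    {s : Fin m →₀ ℕ} (hs : coeff s F ≠ 0) (i : Fin m) : s i ≤ d := by
  rw [← sum_eq_of_isHomogeneous hF hs]
  exact Finset.single_le_sum (f := fun i => s i) (fun _ _ => Nat.zero_le _) (Finset.mem_univ i)

theorem exists_isGaloisPoint_of_pow_homology [IsAlgClosed K] [CharZero K] {r n k : ℕ}
    {F : MvPolynomial (Fin (r + 3)) K} {A : GL (Fin (r + 3)) K} (hn : 2 ≤ n)
    (hF : IsSmoothHypersurface F (n + 1)) (hAF : linSubst A.1 F = F)
    (b : Module.Basis (Fin (r + 3)) K (Fin (r + 3) → K)) (i₀ : Fin (r + 3)) {ω : K}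
    (hω : IsPrimitiveRoot ω n)
    (hA : ∀ i, (A ^ k : GL (Fin (r + 3)) K).1 *ᵥ b i = (if i = i₀ then ω else 1) • b i) :
    ∃ P ∈ hypersurface F, IsGaloisPoint F P ∧
      IsGaloisGroupOfProjection F P (Subgroup.zpowers (ProjGenLinGroup.mk A ^ k)) := by
  obtain ⟨T, hT⟩ := exists_GL_of_basis (b.reindex (Equiv.swap 0 i₀))
  have hB : (A ^ k : GL (Fin (r + 3)) K).1 * T.1 = T.1 * homologyMatrix (r + 2) ω := by
    refine mul_eq_mul_diagonal hT fun i => ?_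
    rw [Module.Basis.reindex_apply, Equiv.symm_swap, hA]
    congr 1
    refine Fin.cases ?_ (fun j => ?_) i
    · simp
    · rw [if_neg, Fin.cons_succ]
      rw [Equiv.swap_apply_eq_iff, Equiv.swap_apply_right]
      exact Fin.succ_ne_zero j
  rw [← map_pow]
  refine exists_isGaloisPoint_of_homology (by omega) hF hω (fun s hs => ?_) hB
  have hinv : linSubst (homologyMatrix (r + 2) ω) (linSubst T.1 F) = linSubst T.1 F := by
    rw [← linSubst_linSubst_of_mul_eq hB, linSubst_pow_eq_self hAF]
  obtain ⟨t, ht⟩ := (linSubst_homologyMatrix_eq_self_iff hω _).1 hinv s hs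
  have hle := le_of_coeff_ne_zero (isHomogeneous_linSubst T.1 hF.1) hs 0
  -- The X₀-exponent is a multiple of n and at most n + 1 < 2n, so it is 0 or n.
  rw [ht] at hle ⊢
  have : t < 2 := by
    by_contra h
    have : n * 2 ≤ n * t := Nat.mul_le_mul_left n (by omega)
    omega
  interval_cases t <;> simp

/-- Every point of a smooth quadric is a Galois point with trivial Galois group. -/
theorem exists_isGaloisPoint_of_quadric [IsAlgClosed K] [CharZero K] {r : ℕ}
    {F : MvPolynomial (Fin (r + 3)) K} (hF : IsSmoothHypersurface F 2) :
    ∃ P ∈ hypersurface F, IsGaloisPoint F P ∧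
      IsGaloisGroupOfProjection F P (Subgroup.zpowers 1) := by
  have hu : ¬ IsUnit F := fun h => by
    have h1 := (isUnit_iff_totalDegree_of_isReduced.1 h).2
    rw [hF.1.totalDegree hF.ne_zero] at h1
    omega
  obtain ⟨v, hv, hFv⟩ := exists_ne_zero_eval_eq_zero hu
  have he : (Pi.single 0 1 : Fin (r + 3) → K) ≠ 0 := by simp
  -- Move a point of the quadric to e₀. Then X₀² does not occur, so the homology theorem applies
  -- with n = 1, ω = 1 and B = 1.
  obtain ⟨S, hS⟩ := MulAction.exists_smul_eq (SpecialLinearGroup (Fin (r + 3)) K)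
    (Projectivization.mk K _ he) (Projectivization.mk K v hv)
  obtain ⟨T, hT⟩ : ∃ T : GL (Fin (r + 3)) K, T = (S : GL (Fin (r + 3)) K) := ⟨_, rfl⟩
  have hTe : ProjGenLinGroup.mk T • Projectivization.mk K _ he = Projectivization.mk K v hv := by
    rw [hT]; exact hS
  have h0 : eval (Pi.single 0 1) (linSubst T.1 F) = 0 := by
    rw [eval_linSubst, ← mk_mem_hypersurface hF.1 (mulVec_ne_zero T he)]
    change ProjGenLinGroup.mk T • Projectivization.mk K _ he ∈ _
    rw [hTe, mk_mem_hypersurface hF.1, hFv]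
  rw [eval_single_one (isHomogeneous_linSubst T.1 hF.1)] at h0
  rw [← map_one ProjGenLinGroup.mk]
  refine exists_isGaloisPoint_of_homology (T := T) (ω := 1) one_ne_zero hF IsPrimitiveRoot.one
    (fun s hs => ?_) ?_
  · have hle := le_of_coeff_ne_zero (isHomogeneous_linSubst T.1 hF.1) hs 0
    have hne : s 0 ≠ 2 := by
      intro h2
      apply hs
      have hsum := sum_eq_of_isHomogeneous (isHomogeneous_linSubst T.1 hF.1) hs
      rw [Fin.sum_univ_succ, h2] at hsum
      have hz : ∑ i : Fin (r + 2), s i.succ = 0 := by omega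
      rw [Finset.sum_eq_zero_iff] at hz
      rw [← h0]
      congr 1
      ext i
      refine Fin.cases ?_ (fun i => ?_) i
      · simpa using h2
      · simpa using hz i
    omega
  · rw [Units.val_one, one_mul, homologyMatrix_one, mul_one]

theorem exists_isGaloisPoint_of_eigenbasis [IsAlgClosed K] [CharZero K] {n k : ℕ}
    {F : MvPolynomial (Fin 5) K} {A : GL (Fin 5) K} (hn : 2 ≤ n) (hk : 2 ≤ k)
    (hF : IsSmoothHypersurface F (n + 1)) (hA : IsAutomorphism F (ProjGenLinGroup.mk A))
    (hord : orderOf (ProjGenLinGroup.mk A) = k * n)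
    (hline : ¬ ContainsLine (fixedLocus F (ProjGenLinGroup.mk A)))
    (b : Module.Basis (Fin 5) K (Fin 5 → K)) {μ : Fin 5 → K}
    (hb : ∀ i, A.1 *ᵥ b i = μ i • b i) (h2 : μ 2 = 1) (h3 : μ 3 = 1) (h4 : μ 4 = 1) :
    ∃ P ∈ hypersurface F, IsGaloisPoint F P ∧
      IsGaloisGroupOfProjection F P (Subgroup.zpowers (ProjGenLinGroup.mk A ^ k)) := by
  obtain ⟨c, hc⟩ := hA.exists_linSubst_eq hF
  obtain ⟨T, hT⟩ := exists_GL_of_basis b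
  have hAT := mul_eq_mul_diagonal hT hb
  have hFT := hF.linSubst T
  have hcoeff : ∀ s, coeff s (linSubst T.1 F) ≠ 0 → ∏ i, μ i ^ s i = c := by
    intro s hs
    have h := congrArg (coeff s) (linSubst_linSubst_of_mul_eq hAT F)
    have hC : linSubst T.1 (C c) = C c := by simp [linSubst]
    rw [hc, map_mul, hC, coeff_C_mul, coeff_linSubst_diagonal] at h
    exact (mul_right_cancel₀ hs h).symm
  have hμ0 : ∀ i, μ i ≠ 0 := by
    intro i h0
    have h := hb i
    rw [h0, zero_smul] at h
    exact mulVec_ne_zero A (b.ne_zero i) h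
  -- Otherwise every monomial is divisible by X₀ or X₁, and F vanishes on the pointwise fixed line
  -- through `b 2` and `b 3`.
  have hplane : ∃ s, coeff s (linSubst T.1 F) ≠ 0 ∧ s 0 = 0 ∧ s 1 = 0 := by
    by_contra! hall
    refine hline ⟨Submodule.span K (Set.range (b ∘ ![2, 3])), ?_, fun p hp => ?_⟩
    · have := finrank_span_eq_card (b.linearIndependent.comp ![2, 3] (by decide))
      rwa [Fintype.card_fin] at this
    · rw [submodule_le_iff_rep_mem, Set.range_comp] at hp
      simp only [range_cons, range_empty, Set.union_empty, Set.singleton_union,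
        Set.image_insert_eq, Set.image_singleton] at hp
      obtain ⟨x, y, hxy⟩ := Submodule.mem_span_pair.1 hp
      refine ⟨?_, (mk_smul_eq_self_iff A p).2 ⟨1, ?_⟩⟩
      · have hTp : p.rep = T.1 *ᵥ (x • Pi.single 2 1 + y • Pi.single 3 1) := by
          rw [mulVec_add, mulVec_smul, mulVec_smul, hT, hT, hxy]
        change eval p.rep F = 0
        rw [hTp, ← eval_linSubst, eval_eq']
        refine Finset.sum_eq_zero fun s hs => ?_
        rw [mem_support_iff] at hs
        have hzero : ∃ i, s i ≠ 0 ∧ (x • Pi.single 2 1 + y • Pi.single 3 1 : Fin 5 → K) i = 0 := by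
          by_cases h0 : s 0 = 0
          · exact ⟨1, hall s hs h0, by simp⟩
          · exact ⟨0, h0, by simp⟩
        obtain ⟨i, hi, hi0⟩ := hzero
        rw [Finset.prod_eq_zero (Finset.mem_univ i), mul_zero]
        rw [hi0, zero_pow hi]
      · rw [← hxy, mulVec_add, mulVec_smul, mulVec_smul, hb, hb, h2, h3, one_smul, one_smul,
          one_smul]
  have hc1 : c = 1 := by
    obtain ⟨s, hs, hs0, hs1⟩ := hplane
    rw [← hcoeff s hs, Fin.prod_univ_five, hs0, hs1, h2, h3, h4]
    simp
  rw [hc1] at hc hcoeff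
  rw [C_1, one_mul] at hc
  have hvertex : ∀ i, ∃ j, μ i ^ n * μ j = 1 := by
    intro i
    obtain ⟨j, hj⟩ := hFT.exists_coeff_ne_zero i
    refine ⟨j, ?_⟩
    rw [← hcoeff _ hj]
    simp only [Finsupp.add_apply, pow_add, Finset.prod_mul_distrib]
    congr 1
    · rw [Finset.prod_eq_single i (fun k _ hk => by rw [Finsupp.single_eq_of_ne hk, pow_zero])
        (by simp), Finsupp.single_eq_same]
    · rw [Finset.prod_eq_single j (fun k _ hk => by rw [Finsupp.single_eq_of_ne hk, pow_zero])
        (by simp), Finsupp.single_eq_same, pow_one]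
  have hordA : ∀ e, μ 1 ^ e = 1 → μ 0 ^ e = 1 → k * n ∣ e := by
    intro e h1 h0
    rw [← hord, orderOf_dvd_iff_pow_eq_one, ← map_pow]
    have hall : ∀ i, μ i ^ e = 1 := by
      intro i
      fin_cases i <;> simp [h0, h1, h2, h3, h4]
    have : (A ^ e : GL (Fin 5) K) = 1 := by
      have h := mul_eq_mul_diagonal hT fun i => pow_mulVec_eq (hb i) e
      rw [funext hall, diagonal_one, mul_one] at h
      exact mul_right_cancel (b := T) (Units.ext (by rw [Units.val_mul, h, one_mul]))
    rw [this, map_one]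
  have hμord : ∀ i, μ i ^ (k * n) = 1 := by
    have h := pow_orderOf_eq_one (ProjGenLinGroup.mk A)
    rw [hord, ← map_pow, ← map_one ProjGenLinGroup.mk, eq_comm,
      ProjGenLinGroup.mk_eq_mk_iff] at h
    obtain ⟨u, hu⟩ := h
    rw [one_mul] at hu
    have hall : ∀ i, μ i ^ (k * n) = u := by
      intro i
      have h1 := pow_mulVec_eq (hb i) (k * n)
      rw [← hu] at h1
      rw [scalar_mulVec] at h1
      exact (smul_left_injective K (b.ne_zero i) h1).symm
    intro i
    -- The scalar u equals 1, as seen on the eigenvalue μ 2 = 1.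
    rw [hall i, ← hall 2, h2, one_pow]
  have hcases : ∀ i, μ i ^ n = 1 ∨ μ i ^ n * μ 0 = 1 ∨ μ i ^ n * μ 1 = 1 := by
    intro i
    obtain ⟨j, hj⟩ := hvertex i
    fin_cases j
    · exact Or.inr (Or.inl hj)
    · exact Or.inr (Or.inr hj)
    · exact Or.inl (by simpa [h2] using hj)
    · exact Or.inl (by simpa [h3] using hj)
    · exact Or.inl (by simpa [h4] using hj)
  rcases pow_eq_one_or_pow_eq_one_of_orders hn hk (hμord 1) (hμord 0) hordA (hcases 0)
    ((hcases 1).imp id Or.symm) with h | h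
  · refine exists_isGaloisPoint_of_pow_homology hn hF hc b 0
      (isPrimitiveRoot_pow_of_orders (by omega) (hμord 0) hordA h) fun i => ?_
    rw [pow_mulVec_eq (hb i)]
    congr 1
    fin_cases i <;> simp [h, h2, h3, h4]
  · refine exists_isGaloisPoint_of_pow_homology hn hF hc b 1
      (isPrimitiveRoot_pow_of_orders (by omega) (hμord 1)
        (fun e h0 h1 => hordA e h1 h0) h) fun i => ?_
    rw [pow_mulVec_eq (hb i)]
    congr 1
    fin_cases i <;> simp [h, h2, h3, h4]

theorem exists_isGaloisPoint [IsAlgClosed K] [CharZero K] {d k : ℕ}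
    {F : MvPolynomial (Fin 5) K} {g : PGL(Fin 5, K)} (hd : 2 ≤ d) (hk : 2 ≤ k)
    (hF : IsSmoothHypersurface F d) (hg : IsAutomorphism F g) (hord : orderOf g = k * (d - 1))
    (hcodim : HasCodimInHypersurface (n := 3) (fixedLocus F g) 2)
    (hline : ¬ ContainsLine (fixedLocus F g)) :
    ∃ P ∈ hypersurface F, IsGaloisPoint F P ∧
      IsGaloisGroupOfProjection F P (Subgroup.zpowers (g ^ k)) := by
  classical
  obtain ⟨n, rfl⟩ := Nat.exists_eq_add_of_le' (show 1 ≤ d by omega)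
  rw [Nat.add_sub_cancel] at hord
  rcases Nat.lt_or_ge n 2 with hn | hn
  · obtain rfl : n = 1 := by omega
    rw [mul_one] at hord
    rw [← hord, pow_orderOf_eq_one]
    exact exists_isGaloisPoint_of_quadric hF
  · obtain ⟨A, rfl⟩ := ProjGenLinGroup.mk_surjective g
    have hN : k * n ≠ 0 := Nat.mul_ne_zero (by omega) (by omega)
    obtain ⟨b, μ, hb⟩ := exists_eigenbasis hN (hord ▸ pow_orderOf_eq_one _)
    -- If not, Fix(g) is finite, and codimension two would read 3 ≤ 0 + 2.
    obtain ⟨c, hc⟩ : ∃ c, 3 ≤ Module.finrank K (Module.End.eigenspace (toLin' A.1) c) := by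
      by_contra! hall
      have hfin := finite_fixedLocus hF.1 A (fun c => Nat.le_of_lt_succ (hall c)) hline
      have hdim := zariskiDim_le_zero_of_finite hfin
      have h2 : (zariskiDim (fixedLocus F (ProjGenLinGroup.mk A)) + (2 : ℕ) : WithBot ℕ∞) = (3 : ℕ) :=
        hcodim
      have h3 := add_le_add_left hdim ((2 : ℕ) : WithBot ℕ∞)
      rw [h2, zero_add] at h3
      have : (3 : ℕ) ≤ 2 := by exact_mod_cast h3
      omega
    obtain ⟨σ, h2, h3, h4⟩ :=
      exists_perm_of_three_le_card (hc.trans (finrank_eigenspace_le_card b hb c))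
    simp only [Finset.mem_filter, Finset.mem_univ, true_and] at h2 h3 h4
    have hc0 : c ≠ 0 := by
      rintro rfl
      have h := hb (σ 2)
      rw [h2, zero_smul] at h
      exact mulVec_ne_zero A (b.ne_zero _) h
    -- Rescaling A by c⁻¹ keeps its class g and makes the repeated eigenvalue equal to 1.
    let u : Kˣ := (Units.mk0 c hc0)⁻¹
    have hmk : ProjGenLinGroup.mk A =
        ProjGenLinGroup.mk (A * GeneralLinearGroup.scalar (Fin 5) u) :=
      ProjGenLinGroup.mk_eq_mk_iff.2 ⟨u, rfl⟩
    rw [hmk] at hg hord hline ⊢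
    refine exists_isGaloisPoint_of_eigenbasis hn hk hF hg hord hline (b.reindex σ.symm)
      (μ := fun i => c⁻¹ * μ (σ i)) (fun i => ?_) ?_ ?_ ?_
    · rw [Module.Basis.reindex_apply, Equiv.symm_symm, Units.val_mul, ← mulVec_mulVec]
      rw [scalar_mulVec, mulVec_smul, hb, smul_smul]
      simp [u]
    · simp [h2, hc0]
    · simp [h3, hc0]
    · simp [h4, hc0]

end PositiveResult

/-! ### Dimension of a line with finitely many extra points. -/

section Dimension

variable {K : Type*} [Field K] {m : ℕ}

theorem infinite_points_on_line [Infinite K] {W : Submodule K (Fin m → K)}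
    (hW : 2 ≤ Module.finrank K W) : {p : ℙ K (Fin m → K) | p.rep ∈ W}.Infinite := by
  have hnt : ∃ v w : W, LinearIndependent K ![v, w] := by
    have := Module.nontrivial_of_finrank_pos (R := K) (M := W) (by omega)
    obtain ⟨v, hv⟩ := exists_ne (0 : W)
    obtain ⟨w, hw⟩ := exists_linearIndependent_pair_of_one_lt_finrank (R := K) (M := W)
      (by omega) hv
    exact ⟨v, w, hw⟩
  obtain ⟨v, w, hvw⟩ := hnt
  rw [LinearIndependent.pair_iff] at hvw
  have hne : ∀ s : K, (v : Fin m → K) + s • (w : Fin m → K) ≠ 0 := by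
    intro s h
    have := hvw 1 s (Subtype.ext (by simpa using h))
    exact one_ne_zero this.1
  refine Set.infinite_of_injective_forall_mem
    (f := fun s : K => Projectivization.mk K _ (hne s)) (fun s t hst => ?_) fun s => ?_
  · rw [Projectivization.mk_eq_mk_iff'] at hst
    obtain ⟨a, ha⟩ := hst
    have := hvw (a - 1) (a * t - s) (Subtype.ext (by
      have : a • ((v : Fin m → K) + t • (w : Fin m → K)) -
        ((v : Fin m → K) + s • (w : Fin m → K)) = 0 := by rw [ha, sub_self]
      rw [Submodule.coe_zero, ← this]
      simp only [Submodule.coe_add, Submodule.coe_smul]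
      module))
    have ha1 : a = 1 := sub_eq_zero.1 this.1
    rw [ha1, one_mul] at this
    exact (sub_eq_zero.1 this.2).symm
  · change _ ∈ W
    obtain ⟨a, ha⟩ := Projectivization.exists_smul_eq_mk_rep K _ (hne s)
    rw [← ha]
    exact W.smul_mem _ (W.add_mem v.2 (W.smul_mem _ w.2))

/-- A line together with finitely many points has dimension one. -/
theorem zariskiDim_eq_one [Infinite K] {W : Submodule K (Fin m → K)}
    (hW : Module.finrank K W = 2) {Z : Set (ℙ K (Fin m → K))}
    (hWZ : ∀ p : ℙ K (Fin m → K), p.rep ∈ W → p ∈ Z)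
    (hfin : {p : ℙ K (Fin m → K) | p ∈ Z ∧ p.rep ∉ W}.Finite) : zariskiDim Z = 1 := by
  let := zariskiTopology K m
  have : T1Space (ℙ K (Fin m → K)) := t1Space_zariskiTopology
  let l : Set Z := {z | z.1.rep ∈ W}
  have hl_inf : l.Infinite := by
    have h := infinite_points_on_line hW.ge
    have himg : Subtype.val '' l = {p : ℙ K (Fin m → K) | p.rep ∈ W} := by
      ext p
      exact ⟨by rintro ⟨z, hz, rfl⟩; exact hz, fun hp => ⟨⟨p, hWZ p hp⟩, hp, rfl⟩⟩
    rw [← himg] at h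
    exact h.of_image _
  have hlc_fin : lᶜ.Finite := by
    refine Set.Finite.of_finite_image (f := Subtype.val) (hfin.subset ?_)
      Subtype.val_injective.injOn
    rintro _ ⟨z, hz, rfl⟩
    exact ⟨z.2, hz⟩
  -- Nonempty open subsets of l are cofinite. As l is infinite, any two of them meet, which is
  -- irreducibility.
  have hopen : ∀ U : Set Z, IsOpen U → (l ∩ U).Nonempty → (l \ U).Finite := by
    rintro _ ⟨U, hU, rfl⟩ ⟨z, hzl, hzU⟩
    refine Set.Finite.of_finite_image (f := Subtype.val)
      ((finite_line_diff_open hW.le hU ⟨z.1, hzU, hzl⟩).subset ?_) Subtype.val_injective.injOn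
    rintro _ ⟨y, hy, rfl⟩
    exact ⟨hy.1, hy.2⟩
  have hirr : IsIrreducible l := by
    refine ⟨hl_inf.nonempty, fun U V hU hV hlU hlV => ?_⟩
    by_contra h
    refine hl_inf (((hopen U hU hlU).union (hopen V hV hlV)).subset fun z hz => ?_)
    by_cases hzU : z ∈ U
    · exact Or.inr ⟨hz, fun hzV => h ⟨z, hz, hzU, hzV⟩⟩
    · exact Or.inl ⟨hz, hzU⟩
  -- A closed set not containing l is finite, and in a T₁ space a finite irreducible set is a single
  -- point.
  have hbig : ∀ C : TopologicalSpace.IrreducibleCloseds Z, (C : Set Z).Nontrivial →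
      l ⊆ (C : Set Z) := by
    intro C hC
    by_contra hlC
    obtain ⟨z, hzl, hzC⟩ := Set.not_subset.1 hlC
    have h1 := hopen _ C.isClosed.isOpen_compl ⟨z, hzl, hzC⟩
    have hCfin : (C : Set Z).Finite := (h1.union hlc_fin).subset fun y hy => by
      by_cases hyl : y ∈ l
      · exact Or.inl ⟨hyl, fun h => h hy⟩
      · exact Or.inr hyl
    obtain ⟨x, hx, y, hy, hxy⟩ := hC
    have hsub : (C : Set Z) ⊆ {x} ∪ ((C : Set Z) \ {x}) := fun w hw => by
      by_cases h : w = x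
      · exact Or.inl h
      · exact Or.inr ⟨hw, h⟩
    rcases isPreirreducible_iff_isClosed_union_isClosed.1 C.isIrreducible.isPreirreducible
      {x} ((C : Set Z) \ {x}) isClosed_singleton (hCfin.subset Set.sdiff_subset).isClosed hsub
      with h | h
    · exact hxy (h hy).symm
    · exact (h hx).2 rfl
  change Order.krullDim (TopologicalSpace.IrreducibleCloseds Z) = 1
  refine le_antisymm (Order.krullDim_le_one_iff.2 fun C => ?_) (Order.one_le_krullDim_iff.2 ?_)
  -- In a chain C₀ < C < C₂ the set C has two points, so it contains the closure of l. Then C₂ is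
  -- covered by that closure and a finite closed set, which contradicts its irreducibility.
  · by_contra! h
    obtain ⟨hmin, hmax⟩ := h
    rw [not_isMin_iff] at hmin
    rw [not_isMax_iff] at hmax
    obtain ⟨C₀, h₀⟩ := hmin
    obtain ⟨C₂, h₂⟩ := hmax
    have hC : (C : Set Z).Nontrivial := by
      obtain ⟨x, hx⟩ := C₀.isIrreducible.nonempty
      obtain ⟨y, hy, hy0⟩ := Set.exists_of_ssubset (show (C₀ : Set Z) ⊂ C from h₀)
      exact ⟨x, h₀.le hx, y, hy, fun h => hy0 (h ▸ hx)⟩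
    have hcl : closure l ⊆ (C : Set Z) := closure_minimal (hbig C hC) C.isClosed
    have hsub : (C₂ : Set Z) ⊆ closure l ∪ lᶜ := fun z _ => by
      by_cases hz : z ∈ l
      · exact Or.inl (subset_closure hz)
      · exact Or.inr hz
    rcases isPreirreducible_iff_isClosed_union_isClosed.1 C₂.isIrreducible.isPreirreducible
      _ _ isClosed_closure hlc_fin.isClosed hsub with h | h
    · exact h₂.not_ge (h.trans hcl)
    · exact hl_inf (hlc_fin.subset (fun z hz => h (h₂.le (hbig C hC hz))))
  · obtain ⟨z, hz⟩ := hl_inf.nonempty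
    refine ⟨⟨{z}, isIrreducible_singleton, isClosed_singleton⟩,
      ⟨closure l, hirr.closure, isClosed_closure⟩, ?_⟩
    refine lt_of_le_of_ne (fun y hy => ?_) fun h => ?_
    · rw [show y = z from hy]
      exact subset_closure hz
    · have hs : ({z} : Set Z) = closure l := 
        congrArg (fun C : TopologicalSpace.IrreducibleCloseds Z => (C : Set Z)) h
      exact hl_inf ((Set.finite_singleton z).subset (hs ▸ subset_closure))

end Dimension

/-! ### The counterexample of part (2). -/

section Example

variable {K : Type*} [Field K]

theorem isAutomorphism_of_linSubst_eq {m d : ℕ} {F : MvPolynomial (Fin m) K}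
    (hF : F.IsHomogeneous d) {A : GL (Fin m) K} {c : K} (hc : c ≠ 0)
    (hA : linSubst A.1 F = C c * F) : IsAutomorphism F (ProjGenLinGroup.mk A) := by
  have key : ∀ (B : GL (Fin m) K) (c : K), linSubst B.1 F = C c * F →
      ∀ p ∈ hypersurface F, ProjGenLinGroup.mk B • p ∈ hypersurface F := by
    intro B c hB p hp
    rw [mk_smul_eq_mk_rep B p (mulVec_ne_zero B p.rep_nonzero), mk_mem_hypersurface hF,
      ← eval_linSubst, hB, map_mul, show eval p.rep F = 0 from hp, mul_zero]
  refine Set.Subset.antisymm ?_ fun p hp => ?_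
  · rintro _ ⟨p, hp, rfl⟩
    exact key A c hA p hp
  · refine ⟨ProjGenLinGroup.mk A⁻¹ • p, key _ _ (linSubst_inv_eq hc hA) p hp, ?_⟩
    change ProjGenLinGroup.mk A • ProjGenLinGroup.mk A⁻¹ • p = p
    rw [smul_smul, ← map_mul, mul_inv_cancel, map_one, one_smul]

/-- The span of the coordinate vectors `eᵢ` and `eⱼ`. -/
def coordinateLine {m : ℕ} (i j : Fin m) : Submodule K (Fin m → K) :=
  Submodule.span K (Set.range (Pi.basisFun K (Fin m) ∘ ![i, j]))

theorem finrank_coordinateLine {m : ℕ} {i j : Fin m} (hij : i ≠ j) :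
    Module.finrank K (coordinateLine (K := K) i j) = 2 := by
  have hinj : Function.Injective ![i, j] := by
    intro a b h
    fin_cases a <;> fin_cases b <;> simp_all [hij.symm]
  have := finrank_span_eq_card ((Pi.basisFun K (Fin m)).linearIndependent.comp _ hinj)
  rwa [Fintype.card_fin] at this

theorem mem_coordinateLine {m : ℕ} {i j : Fin m} (hij : i ≠ j) {v : Fin m → K} :
    v ∈ coordinateLine i j ↔ ∀ k, k ≠ i → k ≠ j → v k = 0 := by
  rw [coordinateLine, Set.range_comp]
  simp only [range_cons, range_empty, Set.union_empty, Set.singleton_union,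
    Set.image_insert_eq, Set.image_singleton, Submodule.mem_span_pair, Pi.basisFun_apply]
  constructor
  · rintro ⟨a, b, rfl⟩ k hi hj
    simp [hi, hj]
  · intro h
    refine ⟨v i, v j, ?_⟩
    funext k
    by_cases hi : k = i
    · subst hi; simp [hij]
    · by_cases hj : k = j
      · subst hj; simp [hi]
      · simp [hi, hj, h k hi hj]

theorem eval_exampleForm (d : ℕ) (v : Fin 5 → K) : eval v (exampleForm K d) =
    v 0 ^ d + v 1 ^ d + v 2 ^ d + v 0 * v 3 ^ (d - 1) + v 1 * v 4 ^ (d - 1) := by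
  simp [exampleForm]

theorem isHomogeneous_exampleForm {d : ℕ} (hd : 1 ≤ d) :
    (exampleForm K d).IsHomogeneous d := by
  have h : ∀ i j : Fin 5, (X i * X j ^ (d - 1) : MvPolynomial (Fin 5) K).IsHomogeneous d := by
    intro i j
    have := (isHomogeneous_X K i).mul (isHomogeneous_X_pow (R := K) j (d - 1))
    rwa [show 1 + (d - 1) = d by omega] at this
  exact ((((isHomogeneous_X_pow 0 d).add (isHomogeneous_X_pow 1 d)).add
    (isHomogeneous_X_pow 2 d)).add (h 0 3)).add (h 1 4)

theorem isSmoothHypersurface_exampleForm [CharZero K] {d : ℕ} (hd : 3 ≤ d) :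
    IsSmoothHypersurface (exampleForm K d) d := by
  refine ⟨isHomogeneous_exampleForm (by omega), fun v hv _ => ?_⟩
  by_contra! h
  obtain ⟨n, rfl⟩ := Nat.exists_eq_add_of_le' hd
  have hn : ((n : K) + 3) ≠ 0 := by exact_mod_cast (Nat.succ_ne_zero (n + 2))
  have hn' : ((n : K) + 2) ≠ 0 := by exact_mod_cast (Nat.succ_ne_zero (n + 1))
  have e0 := h 0
  have e1 := h 1
  have e2 := h 2
  have e3 := h 3
  have e4 := h 4
  simp [exampleForm, pderiv_X, hn, hn'] at e0 e1 e2 e3 e4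
  -- With d = n + 3, the partial derivative in X₃ makes X₀ or X₃ vanish, and the one in X₀ then
  -- makes both vanish. The pair X₁, X₄ behaves alike.
  have key : ∀ x y : K, (n + 3) * x ^ (n + 2) + y ^ (n + 2) = 0 → x = 0 ∨ y = 0 →
      x = 0 ∧ y = 0 := by
    rintro x y h (rfl | rfl)
    · simpa using h
    · simpa [hn] using h
  obtain ⟨h0, h3⟩ := key _ _ e0 e3
  obtain ⟨h1, h4⟩ := key _ _ e1 e4
  apply hv
  funext i
  fin_cases i
  exacts [h0, h1, e2, h3, h4]

variable {d : ℕ} {ζ : Kˣ}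

/-- The diagonal matrix with entries `ζᵈ, ζᵈ, ζ, 1, 1`. -/
def exampleMatrix (d : ℕ) (ζ : Kˣ) : GL (Fin 5) K :=
  Units.map (diagonalRingHom (Fin 5) K).toMonoidHom
    (MulEquiv.piUnits.symm ![ζ ^ d, ζ ^ d, ζ, 1, 1])

theorem exampleAut_eq : exampleAut d ζ = ProjGenLinGroup.mk (exampleMatrix d ζ) := rfl

theorem exampleMatrix_pow_val (e : ℕ) : (exampleMatrix d ζ ^ e).1 =
    diagonal ![((ζ : K) ^ d) ^ e, ((ζ : K) ^ d) ^ e, (ζ : K) ^ e, 1, 1] := by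
  have h : (exampleMatrix d ζ).1 = diagonal ![(ζ : K) ^ d, (ζ : K) ^ d, (ζ : K), 1, 1] := by
    ext i j
    fin_cases i <;> fin_cases j <;> simp [exampleMatrix]
  rw [Units.val_pow_eq_pow_val, h, diagonal_pow]
  congr 1
  funext i
  fin_cases i <;> simp

theorem exampleMatrix_val : (exampleMatrix d ζ).1 =
    diagonal ![(ζ : K) ^ d, (ζ : K) ^ d, (ζ : K), 1, 1] := by
  have := exampleMatrix_pow_val (d := d) (ζ := ζ) 1
  simpa using this

theorem orderOf_exampleAut (hζ : IsPrimitiveRoot ζ (d * (d - 1))) :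
    orderOf (exampleAut d ζ) = d * (d - 1) := by
  rw [exampleAut_eq]
  apply Nat.dvd_antisymm
  · rw [orderOf_dvd_iff_pow_eq_one, ← map_pow]
    have h1 : (ζ : K) ^ (d * (d - 1)) = 1 := by
      rw [← Units.val_pow_eq_pow_val, hζ.pow_eq_one, Units.val_one]
    have : exampleMatrix d ζ ^ (d * (d - 1)) = 1 := by
      apply Units.ext
      rw [exampleMatrix_pow_val, ← pow_mul, mul_comm d (d * (d - 1)), pow_mul, h1, one_pow,
        Units.val_one, ← diagonal_one]
      congr 1
      funext i
      fin_cases i <;> rfl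
    rw [this, map_one]
  · have h := pow_orderOf_eq_one (ProjGenLinGroup.mk (exampleMatrix d ζ))
    rw [← map_pow, ← map_one ProjGenLinGroup.mk, eq_comm, ProjGenLinGroup.mk_eq_mk_iff] at h
    obtain ⟨u, hu⟩ := h
    rw [one_mul] at hu
    have hu' := congrArg Units.val hu
    rw [exampleMatrix_pow_val] at hu'
    have h2 := congrFun (congrFun hu' 2) 2
    have h4 := congrFun (congrFun hu' 4) 4
    simp at h2 h4
    apply hζ.dvd_of_pow_eq_one
    rw [h4] at h2
    exact Units.ext (by rw [Units.val_pow_eq_pow_val, ← h2, Units.val_one])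

/-- This makes the form semi-invariant with factor ζᵈ, and gives gᵈ = diag(ζᵈ, ζᵈ, ζᵈ, 1, 1). -/
theorem pow_mul_self_eq (hd : 1 ≤ d) (hζ : IsPrimitiveRoot ζ (d * (d - 1))) :
    ((ζ : K) ^ d) ^ d = (ζ : K) ^ d := by
  have h1 : (ζ : K) ^ (d * (d - 1)) = 1 := by
      rw [← Units.val_pow_eq_pow_val, hζ.pow_eq_one, Units.val_one]
  obtain ⟨n, rfl⟩ := Nat.exists_eq_add_of_le' hd
  rw [Nat.add_sub_cancel] at h1
  rw [← pow_mul, mul_add, mul_one, pow_add, h1, one_mul]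

theorem pow_ne_one_of_lt (hd : 3 ≤ d) (hζ : IsPrimitiveRoot ζ (d * (d - 1))) {e : ℕ}
    (he0 : e ≠ 0) (he : e ≤ d) : (ζ : K) ^ e ≠ 1 := by
  intro h
  have h1 : ζ ^ e = 1 := Units.ext (by simpa using h)
  have h2 := Nat.le_of_dvd (Nat.pos_of_ne_zero he0) (hζ.dvd_of_pow_eq_one _ h1)
  have h3 : d * 2 ≤ d * (d - 1) := Nat.mul_le_mul_left d (by omega)
  omega

theorem linSubst_exampleMatrix (hd : 1 ≤ d) (hζ : IsPrimitiveRoot ζ (d * (d - 1))) :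
    linSubst (exampleMatrix d ζ).1 (exampleForm K d) = C ((ζ : K) ^ d) * exampleForm K d := by
  have h := pow_mul_self_eq hd hζ
  rw [exampleMatrix_val]
  simp only [exampleForm, map_add, map_mul, map_pow, linSubst_diagonal_X, mul_pow]
  simp only [← map_pow C, cons_val_zero, cons_val_one, cons_val, h, one_pow, C_1]
  ring

theorem mem_fixedLocus_example_of_mem_line (hd : 3 ≤ d) {p : ℙ K (Fin 5 → K)}
    (hp : p.rep ∈ coordinateLine (K := K) (3 : Fin 5) 4) :
    p ∈ fixedLocus (exampleForm K d) (exampleAut d ζ) := by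
  rw [mem_coordinateLine (by decide)] at hp
  have h0 := hp 0 (by decide) (by decide)
  have h1 := hp 1 (by decide) (by decide)
  have h2 := hp 2 (by decide) (by decide)
  have hd0 : d ≠ 0 := by omega
  refine ⟨?_, ?_⟩
  · change eval p.rep _ = 0
    rw [eval_exampleForm, h0, h1, h2]
    simp [hd0]
  · rw [exampleAut_eq, mk_smul_eq_self_iff]
    refine ⟨1, ?_⟩
    rw [exampleMatrix_val]
    funext i
    rw [mulVec_diagonal, one_smul]
    fin_cases i <;> simp [h0, h1, h2]

theorem containsLine_example (hd : 3 ≤ d) :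
    ContainsLine (fixedLocus (exampleForm K d) (exampleAut d ζ)) :=
  ⟨coordinateLine 3 4, finrank_coordinateLine (by decide), fun _ hp =>
    mem_fixedLocus_example_of_mem_line hd (submodule_le_iff_rep_mem.1 hp)⟩

/-- The eigenvalues ζᵈ, ζ, 1 are distinct. The ζ-eigenspace gives e₂, which is not on X, and the
ζᵈ-eigenspace is a line not contained in X. -/
theorem finite_fixedLocus_example_off_line (hd : 3 ≤ d) (hζ : IsPrimitiveRoot ζ (d * (d - 1))) :
    {p : ℙ K (Fin 5 → K) | p ∈ fixedLocus (exampleForm K d) (exampleAut d ζ) ∧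
      p.rep ∉ coordinateLine (K := K) (3 : Fin 5) 4}.Finite := by
  have hd0 : d ≠ 0 := by omega
  have hd1 : d - 1 ≠ 0 := by omega
  have hζ1 : (ζ : K) ≠ 1 := by
    simpa using pow_ne_one_of_lt hd hζ one_ne_zero (by omega)
  have hζd : (ζ : K) ^ d ≠ 1 := pow_ne_one_of_lt hd hζ hd0 le_rfl
  have hζd1 : (ζ : K) ^ d ≠ ζ := by
    intro h
    apply pow_ne_one_of_lt hd hζ hd1 (by omega)
    apply mul_right_cancel₀ ζ.ne_zero
    rw [← pow_succ, Nat.sub_add_cancel (by omega), h, one_mul]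
  have he : (Pi.single 0 1 : Fin 5 → K) ≠ 0 := by simp
  let p₀ : ℙ K (Fin 5 → K) := Projectivization.mk K _ he
  have hp₀ : p₀.rep ∈ coordinateLine (K := K) (0 : Fin 5) 1 := by
    obtain ⟨a, ha⟩ := Projectivization.exists_smul_eq_mk_rep K _ he
    rw [← ha]
    refine Submodule.smul_mem _ _ (Submodule.subset_span ⟨0, ?_⟩)
    simp
  have hFp₀ : eval p₀.rep (exampleForm K d) ≠ 0 := by
    rw [Ne, eval_rep_mk_eq_zero_iff (isHomogeneous_exampleForm (by omega)) he, eval_exampleForm]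
    simp [hd0, hd1]
  refine (finite_zeros_on_line (finrank_coordinateLine (by decide)).le
    (isHomogeneous_exampleForm (by omega)) hp₀ hFp₀).subset ?_
  rintro p ⟨⟨hpF, hp⟩, hpl⟩
  refine ⟨?_, hpF⟩
  change eval p.rep _ = 0 at hpF
  rw [eval_exampleForm] at hpF
  rw [exampleAut_eq, mk_smul_eq_self_iff] at hp
  obtain ⟨c, hc⟩ := hp
  rw [exampleMatrix_val] at hc
  have hci : ∀ i, p.rep i ≠ 0 → (![(ζ : K) ^ d, (ζ : K) ^ d, (ζ : K), 1, 1] : Fin 5 → K) i = c := by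
    intro i hi
    have := congrFun hc i
    rw [mulVec_diagonal, Pi.smul_apply, smul_eq_mul] at this
    exact mul_right_cancel₀ hi this
  have hc1 : c ≠ 1 := by
    rintro rfl
    apply hpl
    rw [mem_coordinateLine (by decide)]
    intro k hk3 hk4
    by_contra hk
    have := hci k hk
    fin_cases k
    exacts [hζd this, hζd this, hζ1 this, hk3 rfl, hk4 rfl]
  have h3 : p.rep 3 = 0 := by
    by_contra h
    exact hc1 (hci 3 h).symm
  have h4 : p.rep 4 = 0 := by
    by_contra h
    exact hc1 (hci 4 h).symm
  have h2 : p.rep 2 = 0 := by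
    by_contra h
    have hcζ : (ζ : K) = c := hci 2 h
    have h0 : p.rep 0 = 0 := by
      by_contra h0
      exact hζd1 ((hci 0 h0).trans hcζ.symm)
    have h1 : p.rep 1 = 0 := by
      by_contra h1
      exact hζd1 ((hci 1 h1).trans hcζ.symm)
    rw [h0, h1, h3, h4] at hpF
    simp [hd0, h] at hpF
  rw [mem_coordinateLine (by decide)]
  intro k hk0 hk1
  fin_cases k
  exacts [absurd rfl hk0, absurd rfl hk1, h2, h3, h4]

theorem hasCodimInHypersurface_example [CharZero K] (hd : 3 ≤ d)
    (hζ : IsPrimitiveRoot ζ (d * (d - 1))) :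
    HasCodimInHypersurface (n := 3) (fixedLocus (exampleForm K d) (exampleAut d ζ)) 2 := by
  rw [HasCodimInHypersurface, zariskiDim_eq_one (finrank_coordinateLine (by decide))
    (fun p hp => mem_fixedLocus_example_of_mem_line hd hp)
    (finite_fixedLocus_example_off_line hd hζ)]
  norm_num

/-- A linear form in `Xᵢ` and `Xⱼ` that vanishes at a given point. -/
theorem exists_linear_form_eval_eq_zero {m : ℕ} (v : Fin m → K) {i j : Fin m} (hij : i ≠ j) :
    ∃ a b : K, (C a * X i + C b * X j : MvPolynomial (Fin m) K) ≠ 0 ∧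
      eval v (C a * X i + C b * X j) = 0 := by
  have hne : ∀ a b : K, a ≠ 0 ∨ b ≠ 0 → (C a * X i + C b * X j : MvPolynomial (Fin m) K) ≠ 0 := by
    intro a b hab h
    have h1 := congrArg (eval (Pi.single i 1)) h
    have h2 := congrArg (eval (Pi.single j 1)) h
    simp [hij, hij.symm] at h1 h2
    exact hab.elim (fun ha => ha h1) (fun hb => hb h2)
  by_cases h : v i = 0
  · exact ⟨1, 0, hne _ _ (Or.inl one_ne_zero), by simp [h]⟩
  · exact ⟨v j, -v i, hne _ _ (Or.inr (neg_ne_zero.2 h)), by simp; ring⟩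

/-- gᵈ has eigenspaces of dimensions 3 and 2, so each block of coordinates carries a nonzero linear
form vanishing at P. Their ratio lies in `projectionField` but is multiplied by ζᵈ. -/
theorem not_isGaloisGroupOfProjection_example [CharZero K] (hd : 3 ≤ d)
    (hζ : IsPrimitiveRoot ζ (d * (d - 1))) (P : ℙ K (Fin 5 → K)) :
    ¬ IsGaloisGroupOfProjection (exampleForm K d) P
      (Subgroup.zpowers (exampleAut d ζ ^ d)) := by
  rintro ⟨hprime, e, he⟩
  have hsm := isSmoothHypersurface_exampleForm (K := K) hd
  obtain ⟨a, b, hl0, hlP⟩ := exists_linear_form_eval_eq_zero P.rep (i := 0) (j := 1) (by decide)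
  obtain ⟨a', b', hl0', hlP'⟩ := exists_linear_form_eval_eq_zero P.rep (i := 3) (j := 4)
    (by decide)
  set l : MvPolynomial (Fin 5) K := C a * X 0 + C b * X 1 with hl
  set l' : MvPolynomial (Fin 5) K := C a' * X 3 + C b' * X 4 with hl'
  have hl1 : l.IsHomogeneous 1 := (isHomogeneous_C_mul_X _ _).add (isHomogeneous_C_mul_X _ _)
  have hl1' : l'.IsHomogeneous 1 := (isHomogeneous_C_mul_X _ _).add (isHomogeneous_C_mul_X _ _)
  have hlF : l ∉ Ideal.span {exampleForm K d} :=
    notMem_span_of_isHomogeneous hsm.1 hsm.ne_zero hl1 hl0 (by omega)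
  have hlF' : l' ∉ Ideal.span {exampleForm K d} :=
    notMem_span_of_isHomogeneous hsm.1 hsm.ne_zero hl1' hl0' (by omega)
  let x : functionField (exampleForm K d) := ⟨cls _ l / cls _ l',
    1, l, l', Algebra.mem_top, Algebra.mem_top, hl1, hl1', hlF', rfl⟩
  have hx : x ∈ projectionField (exampleForm K d) P :=
    ⟨1, l, l', Algebra.subset_adjoin ⟨hl1, hlP⟩, Algebra.subset_adjoin ⟨hl1', hlP'⟩,
      hl1, hl1', hlF', rfl⟩
  -- The inverse is taken so that `h` acts by substituting the matrix of gᵈ itself.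
  let h : Subgroup.zpowers (exampleAut d ζ ^ d) :=
    ⟨(exampleAut d ζ ^ d)⁻¹, inv_mem (Subgroup.mem_zpowers _)⟩
  have hpb := (he h (exampleMatrix d ζ ^ d)
    (by rw [map_pow, inv_inv, exampleAut_eq]) 1 l l' x hl1 hl1' hlF' rfl).2
  have hfix : e h x = x := (e h).commutes ⟨x, hx⟩
  rw [hfix] at hpb
  change _ = cls _ (linSubst _ _) / cls _ (linSubst _ _) at hpb
  have hsub : linSubst (exampleMatrix d ζ ^ d : GL (Fin 5) K).1 l = C ((ζ : K) ^ d) * l := by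
    rw [exampleMatrix_pow_val, pow_mul_self_eq (by omega) hζ, hl]
    simp only [map_add, map_mul, linSubst_diagonal_X, algHom_C]
    simp
    ring
  have hsub' : linSubst (exampleMatrix d ζ ^ d : GL (Fin 5) K).1 l' = l' := by
    rw [exampleMatrix_pow_val, hl']
    simp only [map_add, map_mul, linSubst_diagonal_X, algHom_C]
    simp
  rw [hsub, hsub'] at hpb
  have h1 := (div_left_inj' (cls_ne_zero hlF')).1 hpb
  rw [cls_eq_cls_iff, show l - C ((ζ : K) ^ d) * l = C (1 - (ζ : K) ^ d) * l by
    rw [C_sub, C_1]; ring] at h1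
  refine (Ideal.IsPrime.mem_or_mem hprime h1).elim (fun h2 => ?_) hlF
  have hne : (ζ : K) ^ d ≠ 1 := pow_ne_one_of_lt hd hζ (by omega) le_rfl
  exact Ideal.IsPrime.ne_top hprime (Ideal.eq_top_of_isUnit_mem _ h2
    ((IsUnit.mk0 _ (sub_ne_zero.2 hne.symm)).map C))

end Example

end GaloisPoint

theorem mainTheorem3 {K : Type*} [Field K] [IsAlgClosed K] [CharZero K] :
    (∀ (d k : ℕ) (F : MvPolynomial (Fin 5) K) (g : PGL(Fin 5, K)),
      2 ≤ d → 2 ≤ k →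
      GaloisPoint.IsSmoothHypersurface F d →
      GaloisPoint.IsAutomorphism F g →
      orderOf g = k * (d - 1) →
      GaloisPoint.HasCodimInHypersurface (n := 3) (GaloisPoint.fixedLocus F g) 2 →
      ¬ GaloisPoint.ContainsLine (GaloisPoint.fixedLocus F g) →
      ∃ P ∈ GaloisPoint.hypersurface F, GaloisPoint.IsGaloisPoint F P ∧
        GaloisPoint.IsGaloisGroupOfProjection F P (Subgroup.zpowers (g ^ k))) ∧
    (∀ (d : ℕ) (ζ : Kˣ), 3 ≤ d → IsPrimitiveRoot ζ (d * (d - 1)) →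
      GaloisPoint.IsSmoothHypersurface (GaloisPoint.exampleForm K d) d ∧
      GaloisPoint.IsAutomorphism (GaloisPoint.exampleForm K d) (GaloisPoint.exampleAut d ζ) ∧
      orderOf (GaloisPoint.exampleAut d ζ) = d * (d - 1) ∧
      GaloisPoint.HasCodimInHypersurface (n := 3)
        (GaloisPoint.fixedLocus (GaloisPoint.exampleForm K d) (GaloisPoint.exampleAut d ζ)) 2 ∧
      GaloisPoint.ContainsLine
        (GaloisPoint.fixedLocus (GaloisPoint.exampleForm K d) (GaloisPoint.exampleAut d ζ)) ∧
      ¬ ∃ P ∈ GaloisPoint.hypersurface (GaloisPoint.exampleForm K d),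
        GaloisPoint.IsGaloisPoint (GaloisPoint.exampleForm K d) P ∧
        GaloisPoint.IsGaloisGroupOfProjection (GaloisPoint.exampleForm K d) P
          (Subgroup.zpowers (GaloisPoint.exampleAut d ζ ^ d))) := by
  refine ⟨fun d k F g hd hk hF hg hord hcodim hline =>
    GaloisPoint.exists_isGaloisPoint hd hk hF hg hord hcodim hline, fun d ζ hd hζ => ?_⟩
  refine ⟨GaloisPoint.isSmoothHypersurface_exampleForm hd,
    GaloisPoint.isAutomorphism_of_linSubst_eq
      (GaloisPoint.isHomogeneous_exampleForm (by omega)) (pow_ne_zero d ζ.ne_zero)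
      (GaloisPoint.linSubst_exampleMatrix (by omega) hζ),
    GaloisPoint.orderOf_exampleAut hζ, GaloisPoint.hasCodimInHypersurface_example hd hζ,
    GaloisPoint.containsLine_example hd, ?_⟩
  rintro ⟨P, -, -, hP⟩
  exact GaloisPoint.not_isGaloisGroupOfProjection_example hd hζ P hP
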